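/- Let $E_0,E_1$ be (real or complex) Banach spaces with $E_1$ densely and continuously embedded in $E_0$. For $\theta\in(0,1)$ let $E_\theta:=(E_0,E_1)^0_{\theta,\infty}$ be the continuous interpolation space, i.e. the set of $x\in E_0$ with $\lim_{t\to0+}t^{-\theta}K(t,x)=0$, where $K(t,x)=\inf_{y\in E_1}(|x-y|_{E_0}+t|y|_{E_1})$, with norm $|x|_{E_\theta}=\sup_{t>0}t^{-\theta}K(t,x)$. Fix $\mu\in(0,1)$. For $T>0$ and a Banach space $E$, let $BC_{1-\mu}([0,T],E)$ be the set of continuous $v:(0,T]\to E$ such that $t^{1-\mu}v(t)$ is bounded on $(0,T]$ and tends to $0$ in $E$ as $t\to0+$; let $BC^1_{1-\mu}([0,T],E)$ be the set of $v\in C^1((0,T],E)$ with $v,\dot v\in BC_{1-\mu}([0,T],E)$; and put $\mathbb E_{1,\mu}([0,T])=BC^1_{1-\mu}([0,T],E_0)\cap BC_{1-\mu}([0,T],E_1)$. For $u\in\mathbb E_{1,\mu}([0,T])$ the limit $u(0):=\lim_{t\to0+}u(t)$ exists in $E_0$. Let $\mathcal M_\mu(E_1,E_0)$ be the set of bounded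 linear operators $B:E_1\to E_0$ such that, for some $T>0$, for every $f\in BC_{1-\mu}([0,T],E_0)$ and $x\in E_\mu$ there is a unique $u\in\mathbb E_{1,\mu}([0,T])$ with $\dot u+Bu=f$ on $(0,T]$ and $u(0)=x$. Let $V_\mu\subset E_\mu$ be open, and assume: (H1) $(A,F_1):V_\mu\to\mathcal M_\mu(E_1,E_0)\times E_0$ is locally Lipschitz continuous, where $V_\mu$ carries the topology of $E_\mu$ and $\mathcal M_\mu(E_1,E_0)$ the operator norm of $\mathcal L(E_1,E_0)$. (H2) There is $\beta\in(\mu,1)$ with $F_2:V_\mu\cap E_\beta\to E_0$, and there are $m\in\mathbb N$ and numbers $\beta_j\in[\mu,\beta]$, $\rho_j\ge0$ with $$\frac{\rho_j(\beta-\mu)+(\beta_j-\mu)}{1-\mu}\le1\qquad(j=1,\dots,m)$$ such that for each $x_0\in V_\mu$ and $R>0$ there is a constant $C_R=C_R(x_0)>0$ with $$|F_2(x_1)-F_2(x_2)|_{E_0}\le C_R\sum_{j=1}^m\bigl(1+|x_1|_{E_\beta}^{\rho_j}+|x_2|_{E_\beta}^{\rho_j}\bigr)|x_1-x_2|_{E_{\beta_j}}$$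 for all $x_1,x_2\in V_\mu\cap E_\beta$ with $|x_k-x_0|_{E_\mu}\le R$, $k=1,2$. Consider the problem $$\dot u+A(u)u=F_1(u)+F_2(u)\quad(t>0),\qquad u(0)=x. \tag{1}$$ A solution of (1) on $[0,T]$ is a function $u\in\mathbb E_{1,\mu}([0,T])$ with $u(t)\in V_\mu$ for all $t\in[0,T]$ that satisfies the equation on $(0,T]$ and $u(0)=x$; a global solution is a function on $[0,\infty)$ whose restriction to $[0,T]$ is a solution for every $T>0$. An equilibrium is an element $u_*\in V_\mu\cap E_1$ with $A(u_*)u_*=F_1(u_*)+F_2(u_*)$. For $\nu\in(0,1)$ with $\nu\ge\mu$, the equilibrium $u_*$ is called stable in the topology of $E_\nu$ if for every $\varepsilon>0$ there is $\delta>0$ such that for every $x\in E_\nu$ with $|x-u_*|_{E_\nu}<\delta$, problem (1) has a global solution and every solution $u$ of (1), on any interval $[0,T]$, satisfies $|u(t)-u_*|_{E_\nu}<\varepsilon$ for all $t\in[0,T]$. **Proposition.** Let $\bar\mu\in[\beta,1)$ and let $u_*\in V_\mu\cap E_1$ be an equilibrium. Then $u_*$ is stable in the topology of $E_\mu$ if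 and only if $u_*$ is stable in the topology of $E_{\bar\mu}$. -/

import Mathlib

open Set Filter Topology

namespace QuasiPar

variable {E : Type*} [NormedAddCommGroup E] [NormedSpace ℝ E]
variable {E₀ E₁ : Type*} [NormedAddCommGroup E₀] [NormedSpace ℝ E₀]
  [NormedAddCommGroup E₁] [NormedSpace ℝ E₁]

/-! ### Continuous interpolation spaces

The embedding `E₁ ↪ E₀` is an injective bounded linear map `i` with dense range; all spaces between
`E₁` and `E₀` are regarded as subsets of `E₀`. -/

/-- Peetre's functional `K(t, x) = inf {|x - y|_{E₀} + t |y|_{E₁} : y ∈ E₁}`. -/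
noncomputable def kFunctional (i : E₁ →L[ℝ] E₀) (t : ℝ) (x : E₀) : ℝ :=
  ⨅ y : E₁, (‖x - i y‖ + t * ‖y‖)

/-- The continuous interpolation space `E_θ = (E₀, E₁)⁰_{θ,∞}`, `0 < θ < 1`, as a subset of `E₀`:
the `x` with `t ^ (-θ) K(t, x) → 0` as `t → 0+`.  (As `E₁ ⊆ E₀`, one has `K(t, x) ≤ |x|_{E₀}`, so
`t ^ (-θ) K(t, x)` is then bounded on `(0, ∞)` and also tends to `0` at infinity; this set is the
closure of `E₁` in the real interpolation space `(E₀, E₁)_{θ,∞}`.) -/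
def interpSpace (i : E₁ →L[ℝ] E₀) (θ : ℝ) : Set E₀ :=
  {x | Tendsto (fun t : ℝ => t ^ (-θ) * kFunctional i t x) (𝓝[>] 0) (𝓝 0)}

/-- The norm `|x|_{E_θ} = sup {t ^ (-θ) K(t, x) : t > 0}`; the supremum is finite on `E_θ`, and it
is used only there. -/
noncomputable def interpNorm (i : E₁ →L[ℝ] E₀) (θ : ℝ) (x : E₀) : ℝ :=
  ⨆ t : Ioi (0 : ℝ), (t : ℝ) ^ (-θ) * kFunctional i t x

/-- `V` is an open subset of the normed space `E_θ`. -/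
def IsOpenInInterp (i : E₁ →L[ℝ] E₀) (θ : ℝ) (V : Set E₀) : Prop :=
  V ⊆ interpSpace i θ ∧
    ∀ x ∈ V, ∃ r > 0, ∀ y ∈ interpSpace i θ, interpNorm i θ (y - x) < r → y ∈ V

/-! ### Time-weighted spaces on `J = [0, T]` -/

/-- `f ∈ BC_{1-μ}([0, T], E)`; only the values of `f` on `(0, T]` matter. -/
structure IsBC (μ T : ℝ) (f : ℝ → E) : Prop where
  continuousOn : ContinuousOn f (Ioc 0 T)
  bounded : ∃ C : ℝ, ∀ t ∈ Ioc 0 T, ‖t ^ (1 - μ) • f t‖ ≤ C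
  vanishing : Tendsto (fun t : ℝ => ‖t ^ (1 - μ) • f t‖) (𝓝[>] 0) (𝓝 0)

/-- `u ∈ 𝔼_{1,μ}([0, T]) = BC¹_{1-μ}([0, T], E₀) ∩ BC_{1-μ}([0, T], E₁)`, where `v` is `u` regarded
as a function with values in `E₁`, and `u'` is the time derivative of `u` on `(0, T]` (one-sided
at `T`).  At `t = 0` the function `u` takes its trace, i.e. it is continuous there in `E₀`. -/
structure IsMaxRegFun (i : E₁ →L[ℝ] E₀) (μ T : ℝ)
    (u : ℝ → E₀) (v : ℝ → E₁) (u' : ℝ → E₀) : Prop where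
  lift : ∀ t ∈ Ioc 0 T, i (v t) = u t
  hasDeriv : ∀ t ∈ Ioc 0 T, HasDerivWithinAt u (u' t) (Ioc 0 T) t
  bc : IsBC μ T u
  bc_deriv : IsBC μ T u'
  bc_lift : IsBC μ T v
  trace : Tendsto u (𝓝[>] 0) (𝓝 (u 0))

/-- `u ∈ 𝔼_{1,μ}([0, T])` solves `u' + B u = f` on `(0, T]`, `u(0) = x`. -/
def IsLinearSolution (i : E₁ →L[ℝ] E₀) (μ T : ℝ) (B : E₁ →L[ℝ] E₀) (f : ℝ → E₀) (x : E₀)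
    (u : ℝ → E₀) : Prop :=
  ∃ (v : ℝ → E₁) (u' : ℝ → E₀), IsMaxRegFun i μ T u v u' ∧ u 0 = x ∧
    ∀ t ∈ Ioc 0 T, u' t + B (v t) = f t

/-- The class `𝓜_μ(E₁, E₀)` of operators with continuous maximal regularity: for some `T > 0`, the
linear problem has, for all `f ∈ 𝔼_{0,μ}([0, T]) = BC_{1-μ}([0, T], E₀)` and all `x ∈ E_μ`, exactly
one solution in `𝔼_{1,μ}([0, T])`. -/
def maxRegClass (i : E₁ →L[ℝ] E₀) (μ : ℝ) : Set (E₁ →L[ℝ] E₀) :=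
  {B | ∃ T > 0, ∀ f : ℝ → E₀, IsBC μ T f → ∀ x ∈ interpSpace i μ,
    (∃ u : ℝ → E₀, IsLinearSolution i μ T B f x u) ∧
    ∀ u w : ℝ → E₀, IsLinearSolution i μ T B f x u → IsLinearSolution i μ T B f x w →
      EqOn u w (Icc 0 T)}

/-! ### Hypotheses on the quasilinear problem

`A` and `F₁` are functions on `V ⊆ E_μ`, and `F₂` is a function on `V ∩ E_β`; their values elsewhere
in `E₀` are never used. -/

/-- Hypothesis (H1): `(A, F₁) : V → 𝓜_μ(E₁, E₀) × E₀` is locally Lipschitz continuous for the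
norm of `E_μ` on `V` and the operator norm of `L(E₁, E₀)`. -/
structure HypH1 (i : E₁ →L[ℝ] E₀) (μ : ℝ) (V : Set E₀) (A : E₀ → E₁ →L[ℝ] E₀)
    (F₁ : E₀ → E₀) : Prop where
  maxReg : ∀ x ∈ V, A x ∈ maxRegClass i μ
  lipschitz : ∀ x₀ ∈ V, ∃ r > 0, ∃ L : ℝ, ∀ x₁ ∈ V, ∀ x₂ ∈ V,
    interpNorm i μ (x₁ - x₀) < r → interpNorm i μ (x₂ - x₀) < r →
      ‖A x₁ - A x₂‖ ≤ L * interpNorm i μ (x₁ - x₂) ∧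
      ‖F₁ x₁ - F₁ x₂‖ ≤ L * interpNorm i μ (x₁ - x₂)

/-- Hypothesis (H2), with the number `β` made explicit: structural regularity of `F₂` with possibly
critical exponents. -/
def HypH2 (i : E₁ →L[ℝ] E₀) (μ : ℝ) (V : Set E₀) (F₂ : E₀ → E₀) (β : ℝ) : Prop :=
  β ∈ Ioo μ 1 ∧
  ∃ (m : ℕ) (b ρ : Fin m → ℝ),
    (∀ j, b j ∈ Icc μ β ∧ 0 ≤ ρ j ∧ (ρ j * (β - μ) + (b j - μ)) / (1 - μ) ≤ 1) ∧
    ∀ x₀ ∈ V, ∀ R > 0, ∃ C > 0,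
      ∀ x₁ ∈ V ∩ interpSpace i β, ∀ x₂ ∈ V ∩ interpSpace i β,
        interpNorm i μ (x₁ - x₀) ≤ R → interpNorm i μ (x₂ - x₀) ≤ R →
        ‖F₂ x₁ - F₂ x₂‖ ≤ C * ∑ j : Fin m,
          (1 + interpNorm i β x₁ ^ ρ j + interpNorm i β x₂ ^ ρ j) * interpNorm i (b j) (x₁ - x₂)

/-! ### Solutions, equilibria, stability -/

/-- `u ∈ 𝔼_{1,μ}([0, T])` takes values in `V` and solves `u' + A(u) u = F₁(u) + F₂(u)` on `(0, T]`,
`u(0) = x`. -/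
def IsSolution (i : E₁ →L[ℝ] E₀) (μ : ℝ) (V : Set E₀) (A : E₀ → E₁ →L[ℝ] E₀) (F₁ F₂ : E₀ → E₀)
    (T : ℝ) (x : E₀) (u : ℝ → E₀) : Prop :=
  ∃ (v : ℝ → E₁) (u' : ℝ → E₀), IsMaxRegFun i μ T u v u' ∧ u 0 = x ∧
    (∀ t ∈ Icc 0 T, u t ∈ V) ∧
    ∀ t ∈ Ioc 0 T, u' t + A (u t) (v t) = F₁ (u t) + F₂ (u t)

/-- `u` is a global solution with initial value `x`. -/
def IsGlobalSolution (i : E₁ →L[ℝ] E₀) (μ : ℝ) (V : Set E₀) (A : E₀ → E₁ →L[ℝ] E₀)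
    (F₁ F₂ : E₀ → E₀) (x : E₀) (u : ℝ → E₀) : Prop :=
  ∀ T > 0, IsSolution i μ V A F₁ F₂ T x u

/-- `y ∈ V ∩ E₁` is an equilibrium: `A(y) y = F₁(y) + F₂(y)`. -/
def IsEquilibrium (i : E₁ →L[ℝ] E₀) (V : Set E₀) (A : E₀ → E₁ →L[ℝ] E₀) (F₁ F₂ : E₀ → E₀)
    (y : E₁) : Prop :=
  i y ∈ V ∧ A (i y) y = F₁ (i y) + F₂ (i y)

/-- `y` is stable in the topology of `E_ν`: for each `ε > 0` there is `δ > 0` such that for every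
initial value `x` in the ball `B_{E_ν}(y, δ)` the problem has a global solution, and every solution
with this initial value stays in `B_{E_ν}(y, ε)`.  The notion of solution does not depend on `ν`. -/
def IsStableIn (i : E₁ →L[ℝ] E₀) (μ : ℝ) (V : Set E₀) (A : E₀ → E₁ →L[ℝ] E₀) (F₁ F₂ : E₀ → E₀)
    (ν : ℝ) (y : E₀) : Prop :=
  ∀ ε > 0, ∃ δ > 0, ∀ x ∈ interpSpace i ν, interpNorm i ν (x - y) < δ →
    (∃ u : ℝ → E₀, IsGlobalSolution i μ V A F₁ F₂ x u) ∧
    ∀ T > 0, ∀ u : ℝ → E₀, IsSolution i μ V A F₁ F₂ T x u →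
      ∀ t ∈ Icc 0 T, u t ∈ interpSpace i ν ∧ interpNorm i ν (u t - y) < ε

end QuasiPar

/-! Both implications rest on parabolic smoothing over a short time `ε` that is uniform for data
near the equilibrium `y`. The deviation `w = u - y` satisfies `w' + A(y) w = N(w)` with `N(0) = 0`,
where `N` is `remainder`.

The linear input is maximal regularity of the single operator `A(y)`. The class `maxRegClass`
provides only unique solvability on some interval; the closed graph theorem turns it into an
estimate, uniform on all shorter intervals (`MildSolvable.exists_bound`). Although known for the
weight `μ` only, it yields smoothing and boundedness in `E_ν` for every `ν` in `(0, 1)`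
(`MildSolvable.exists_estimate`): one applies it to the time integral of the solution and to the
solution multiplied by time, and passes to the `K`-functional.

The nonlinear input is that `N` has a small Lipschitz constant in the weight `μ`, even for critical
exponents, because the weighted `E₁`-norm of `w` is small (`exists_remainder_lipschitz`). In `E_ν`
with `ν ≥ β` all lower-order norms are dominated by the `E_ν`-norm, so `N` is a small multiple of
`w` there (`exists_remainder_bound`). Hence on `[0, ε]` every solution obeys an a priori bound,
solutions are unique, and one exists that also stays small in `E_ν` when its initial value is small
there (`IsSmallRemainder.a_priori`, `IsSmallRemainder.eqOn`, `IsSmallRemainder.exists_solution`).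

If `y` is stable in `E_μ`, then for `t ≤ ε` uniqueness identifies the solution with the one bounded
in `E_ν`; for `t > ε` one restarts at `t - ε`, where the deviation is small in `E_μ`, and smoothing
makes it small in `E₁`, hence in `E_ν`. Conversely, data small in `E_μ` have a solution on `[0, ε]`
which at time `ε / 2` is small in `E₁`, hence in `E_ν`; stability in `E_ν` takes over from there,
and the `E_ν`-norm dominates the `E_μ`-norm. -/

namespace QuasiPar
variable {E₀ E₁ : Type*} [NormedAddCommGroup E₀] [NormedSpace ℝ E₀]
  [NormedAddCommGroup E₁] [NormedSpace ℝ E₁]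

/-! ### The `K`-functional -/

section KFunctional

variable {i : E₁ →L[ℝ] E₀} {t s : ℝ} {x x' : E₀}

theorem kFunctional_le (ht : 0 ≤ t) (x : E₀) (y : E₁) :
    kFunctional i t x ≤ ‖x - i y‖ + t * ‖y‖ :=
  ciInf_le ⟨0, by rintro _ ⟨y, rfl⟩; positivity⟩ y

theorem le_kFunctional {c : ℝ} (h : ∀ y : E₁, c ≤ ‖x - i y‖ + t * ‖y‖) :
    c ≤ kFunctional i t x :=
  le_ciInf h

theorem kFunctional_nonneg (ht : 0 ≤ t) (x : E₀) : 0 ≤ kFunctional i t x :=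
  le_kFunctional fun y => by positivity

theorem kFunctional_le_norm (ht : 0 ≤ t) (x : E₀) : kFunctional i t x ≤ ‖x‖ := by
  simpa using kFunctional_le (i := i) ht x 0

theorem kFunctional_apply_le (ht : 0 ≤ t) (y : E₁) : kFunctional i t (i y) ≤ t * ‖y‖ := by
  simpa using kFunctional_le (i := i) ht (i y) y

theorem kFunctional_add_le (ht : 0 ≤ t) (x x' : E₀) :
    kFunctional i t (x + x') ≤ kFunctional i t x + kFunctional i t x' := by
  refine le_ciInf_add_ciInf fun y y' => (kFunctional_le ht _ (y + y')).trans ?_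
  have h1 : ‖x + x' - i (y + y')‖ ≤ ‖x - i y‖ + ‖x' - i y'‖ := by
    rw [map_add, add_sub_add_comm]; exact norm_add_le _ _
  have h2 := mul_le_mul_of_nonneg_left (norm_add_le y y') ht
  linarith

theorem kFunctional_neg_le (ht : 0 ≤ t) (x : E₀) : kFunctional i t (-x) ≤ kFunctional i t x := by
  refine le_kFunctional fun y => (kFunctional_le ht _ (-y)).trans (le_of_eq ?_)
  rw [map_neg, norm_neg, ← neg_sub', norm_neg]

theorem kFunctional_neg (ht : 0 ≤ t) (x : E₀) : kFunctional i t (-x) = kFunctional i t x :=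
  le_antisymm (kFunctional_neg_le ht x) (by simpa using kFunctional_neg_le (i := i) ht (-x))

/-- Passage to the infimum. The linear estimates below are proved with a free element `y` of `E₁`,
and this converts them into bounds by the `K`-functional of the initial value. -/
theorem le_mul_kFunctional_add {c C e : ℝ} (hC : 0 < C)
    (h : ∀ y : E₁, c ≤ C * (‖x - i y‖ + t * ‖y‖ + e)) : c ≤ C * (kFunctional i t x + e) := by
  have : c / C - e ≤ kFunctional i t x := le_kFunctional fun y => by
    have := h y
    rw [sub_le_iff_le_add, div_le_iff₀ hC]; linarith
  rw [sub_le_iff_le_add, div_le_iff₀ hC] at this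
  linarith

theorem norm_le_mul_kFunctional_one (x : E₀) : ‖x‖ ≤ max 1 ‖i‖ * kFunctional i 1 x := by
  have h0 : 0 < max 1 ‖i‖ := by positivity
  have := le_mul_kFunctional_add (i := i) (t := 1) (x := x) (c := ‖x‖) (e := 0) h0 fun y => by
    have h1 : ‖x‖ ≤ ‖x - i y‖ + ‖i y‖ := by simpa using norm_add_le (x - i y) (i y)
    have h2 := i.le_opNorm y
    have h3 : ‖x - i y‖ ≤ max 1 ‖i‖ * ‖x - i y‖ :=
      le_mul_of_one_le_left (norm_nonneg _) (le_max_left _ _)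
    have h4 : ‖i‖ * ‖y‖ ≤ max 1 ‖i‖ * ‖y‖ :=
      mul_le_mul_of_nonneg_right (le_max_right _ _) (norm_nonneg _)
    linarith
  simpa using this

end KFunctional

/-! ### Continuous interpolation spaces -/

section Interp

variable {i : E₁ →L[ℝ] E₀} {θ θ' : ℝ} {x x' : E₀}

theorem interpNorm_nonneg (x : E₀) : 0 ≤ interpNorm i θ x :=
  Real.iSup_nonneg fun t => mul_nonneg (Real.rpow_nonneg (le_of_lt t.2) _)
    (kFunctional_nonneg (le_of_lt t.2) _)

theorem interpNorm_le {M : ℝ} (h : ∀ t > 0, kFunctional i t x ≤ t ^ θ * M) :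
    interpNorm i θ x ≤ M := by
  have : Nonempty (Ioi (0 : ℝ)) := ⟨⟨1, mem_Ioi.2 one_pos⟩⟩
  refine ciSup_le fun t => ?_
  have ht : (0 : ℝ) < t := t.2
  rw [Real.rpow_neg ht.le, inv_mul_le_iff₀ (Real.rpow_pos_of_pos ht _)]
  exact h t ht

/-- Near `0` the defining limit bounds the family, and away from `0` the bound `K(t, x) ≤ ‖x‖` does.
Boundedness matters because a real supremum over an unbounded family has the default value `0`. -/
theorem bddAbove_interp (hθ : 0 ≤ θ) (hx : x ∈ interpSpace i θ) :
    BddAbove (range fun t : Ioi (0 : ℝ) => (t : ℝ) ^ (-θ) * kFunctional i t x) := by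
  have h1 : ∀ᶠ t in 𝓝[>] (0 : ℝ), t ^ (-θ) * kFunctional i t x < 1 :=
    (show Tendsto _ _ _ from hx).eventually_lt_const one_pos
  obtain ⟨a, ha, h1⟩ := (eventually_nhdsWithin_iff.1 h1).exists_mem
  obtain ⟨d, hd, hda⟩ := Metric.mem_nhds_iff.1 ha
  refine ⟨max 1 (d ^ (-θ) * ‖x‖), ?_⟩
  rintro _ ⟨⟨t, ht⟩, rfl⟩
  have ht' : (0 : ℝ) < t := ht
  simp only
  rcases lt_or_ge t d with h | h
  · refine le_max_of_le_left (h1 t (hda ?_) ht).le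
    simpa [abs_of_pos ht'] using h
  · refine le_max_of_le_right ?_
    exact mul_le_mul (Real.rpow_le_rpow_of_nonpos hd h (by linarith))
      (kFunctional_le_norm ht'.le x) (kFunctional_nonneg ht'.le x) (by positivity)

theorem kFunctional_le_interpNorm (hθ : 0 ≤ θ) (hx : x ∈ interpSpace i θ) {t : ℝ} (ht : 0 < t) :
    kFunctional i t x ≤ t ^ θ * interpNorm i θ x := by
  have h := le_ciSup (bddAbove_interp hθ hx) ⟨t, ht⟩
  rw [Real.rpow_neg ht.le] at h
  rwa [inv_mul_le_iff₀ (Real.rpow_pos_of_pos ht _)] at h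

theorem apply_mem_interpSpace (hθ : θ < 1) (y : E₁) : i y ∈ interpSpace i θ := by
  have h1 : Tendsto (fun t : ℝ => t ^ (1 - θ) * ‖y‖) (𝓝[>] 0) (𝓝 0) := by
    have := ((Real.continuousAt_rpow_const (0 : ℝ) (1 - θ) (Or.inr (by linarith))).tendsto.mono_left
      (nhdsWithin_le_nhds (s := Ioi 0))).mul_const ‖y‖
    simpa [Real.zero_rpow (by linarith : (1 - θ) ≠ 0)] using this
  refine tendsto_of_tendsto_of_tendsto_of_le_of_le' tendsto_const_nhds h1 ?_ ?_
  · filter_upwards [self_mem_nhdsWithin] with t (ht : 0 < t)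
    exact mul_nonneg (Real.rpow_nonneg ht.le _) (kFunctional_nonneg ht.le _)
  · filter_upwards [self_mem_nhdsWithin] with t (ht : 0 < t)
    have := mul_le_mul_of_nonneg_left (kFunctional_apply_le (i := i) ht.le y)
      (Real.rpow_nonneg ht.le (-θ))
    refine this.trans (le_of_eq ?_)
    rw [← mul_assoc, ← Real.rpow_add_one ht.ne']
    ring_nf

theorem add_mem_interpSpace (hx : x ∈ interpSpace i θ) (hx' : x' ∈ interpSpace i θ) :
    x + x' ∈ interpSpace i θ := by
  have h1 : Tendsto _ _ _ := Tendsto.add hx hx'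
  rw [add_zero] at h1
  refine tendsto_of_tendsto_of_tendsto_of_le_of_le' tendsto_const_nhds h1 ?_ ?_
  · filter_upwards [self_mem_nhdsWithin] with t (ht : 0 < t)
    exact mul_nonneg (Real.rpow_nonneg ht.le _) (kFunctional_nonneg ht.le _)
  · filter_upwards [self_mem_nhdsWithin] with t (ht : 0 < t)
    rw [← mul_add]
    exact mul_le_mul_of_nonneg_left (kFunctional_add_le ht.le _ _) (Real.rpow_nonneg ht.le (-θ))

theorem neg_mem_interpSpace (hx : x ∈ interpSpace i θ) : -x ∈ interpSpace i θ := by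
  refine Tendsto.congr' ?_ (show Tendsto _ _ _ from hx)
  filter_upwards [self_mem_nhdsWithin] with t (ht : 0 < t)
  rw [kFunctional_neg ht.le]

theorem sub_mem_interpSpace (hx : x ∈ interpSpace i θ) (hx' : x' ∈ interpSpace i θ) :
    x - x' ∈ interpSpace i θ := by
  rw [sub_eq_add_neg]; exact add_mem_interpSpace hx (neg_mem_interpSpace hx')

theorem interpNorm_add_le (hθ : 0 ≤ θ) (hx : x ∈ interpSpace i θ) (hx' : x' ∈ interpSpace i θ) :
    interpNorm i θ (x + x') ≤ interpNorm i θ x + interpNorm i θ x' :=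
  interpNorm_le fun t ht => by
    rw [mul_add]
    exact (kFunctional_add_le ht.le _ _).trans (add_le_add (kFunctional_le_interpNorm hθ hx ht)
      (kFunctional_le_interpNorm hθ hx' ht))

theorem interpNorm_neg (x : E₀) : interpNorm i θ (-x) = interpNorm i θ x := by
  unfold interpNorm
  congr 1
  ext t
  rw [kFunctional_neg (le_of_lt t.2)]

theorem interpNorm_zero : interpNorm i θ (0 : E₀) = 0 :=
  le_antisymm (interpNorm_le fun t ht => by
    simpa using kFunctional_le_norm (i := i) ht.le (0 : E₀)) (interpNorm_nonneg _)

theorem interpNorm_apply_le (hθ : θ ∈ Ioo (0 : ℝ) 1) (y : E₁) :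
    interpNorm i θ (i y) ≤ max 1 ‖i‖ * ‖y‖ :=
  interpNorm_le fun t ht => by
    rcases le_total t 1 with h | h
    · refine (kFunctional_apply_le ht.le y).trans ?_
      have h1 : t ≤ t ^ θ := by
        simpa using Real.rpow_le_rpow_of_exponent_ge ht h hθ.2.le
      have h2 : ‖y‖ ≤ max 1 ‖i‖ * ‖y‖ := le_mul_of_one_le_left (norm_nonneg _) (le_max_left _ _)
      exact mul_le_mul h1 h2 (norm_nonneg _) (by positivity)
    · refine (kFunctional_le_norm ht.le _).trans ((i.le_opNorm y).trans ?_)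
      have h1 : 1 ≤ t ^ θ := Real.one_le_rpow h hθ.1.le
      have h2 : ‖i‖ * ‖y‖ ≤ max 1 ‖i‖ * ‖y‖ :=
        mul_le_mul_of_nonneg_right (le_max_right _ _) (norm_nonneg _)
      exact h2.trans (le_mul_of_one_le_left (by positivity) h1)

theorem interpSpace_anti (h : θ ≤ θ') : interpSpace i θ' ⊆ interpSpace i θ := by
  intro x hx
  refine tendsto_of_tendsto_of_tendsto_of_le_of_le' tendsto_const_nhds
    (show Tendsto _ _ _ from hx) ?_ ?_
  · filter_upwards [self_mem_nhdsWithin] with t (ht : 0 < t)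
    exact mul_nonneg (Real.rpow_nonneg ht.le _) (kFunctional_nonneg ht.le _)
  · filter_upwards [Ioo_mem_nhdsGT one_pos] with t ht
    exact mul_le_mul_of_nonneg_right
      (Real.rpow_le_rpow_of_exponent_ge ht.1 ht.2.le (by linarith)) (kFunctional_nonneg ht.1.le _)

theorem interpNorm_le_interpNorm (hθ : 0 ≤ θ) (h : θ ≤ θ') (hx : x ∈ interpSpace i θ') :
    interpNorm i θ x ≤ max 1 ‖i‖ * interpNorm i θ' x :=
  interpNorm_le fun t ht => by
    have h0 : 0 ≤ interpNorm i θ' x := interpNorm_nonneg _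
    rcases le_total t 1 with h1 | h1
    · refine (kFunctional_le_interpNorm (hθ.trans h) hx ht).trans ?_
      exact mul_le_mul (Real.rpow_le_rpow_of_exponent_ge ht h1 h)
        (le_mul_of_one_le_left h0 (le_max_left _ _)) h0 (by positivity)
    · refine (kFunctional_le_norm ht.le _).trans ((norm_le_mul_kFunctional_one (i := i) x).trans ?_)
      have h2 := kFunctional_le_interpNorm (hθ.trans h) hx one_pos
      rw [Real.one_rpow, one_mul] at h2
      have h3 : 1 ≤ t ^ θ := Real.one_le_rpow h1 hθ
      refine (mul_le_mul_of_nonneg_left h2 (by positivity)).trans ?_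
      exact le_mul_of_one_le_left (by positivity) h3

/-- Interpolation between `E_θ` and `E₁`, with the parameter `a` left free. -/
theorem interpNorm_apply_le_of_le (hθ : 0 ≤ θ) (h : θ ≤ θ') (hθ' : θ' < 1) {w : E₁}
    {D P a M : ℝ} (ha : 0 < a) (hD : interpNorm i θ (i w) ≤ D) (hP : ‖w‖ ≤ P)
    (h1 : a ^ (θ - θ') * D ≤ M) (h2 : a ^ (1 - θ') * P ≤ M) : interpNorm i θ' (i w) ≤ M :=
  interpNorm_le fun t ht => by
    have hD0 := (interpNorm_nonneg (i := i) (θ := θ) (i w)).trans hD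
    -- For `t ≥ a` the `E_θ`-bound on the `K`-functional is used, for `t ≤ a` the bound `t * ‖w‖`.
    -- After division by `t ^ θ'` both are largest at `t = a`, which is what `h1` and `h2` control.
    rcases le_total a t with hat | hat
    · have h3 := kFunctional_le_interpNorm hθ (apply_mem_interpSpace (i := i)
        (h.trans_lt hθ') w) ht
      have h4 : t ^ (θ - θ') * D ≤ M := (mul_le_mul_of_nonneg_right
        (Real.rpow_le_rpow_of_nonpos ha hat (by linarith)) hD0).trans h1
      calc _ ≤ t ^ θ * D := h3.trans (mul_le_mul_of_nonneg_left hD (by positivity))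
        _ = t ^ θ' * (t ^ (θ - θ') * D) := by
          rw [← mul_assoc, ← Real.rpow_add ht]; ring_nf
        _ ≤ _ := mul_le_mul_of_nonneg_left h4 (by positivity)
    · have h4 : t ^ (1 - θ') * P ≤ M := (mul_le_mul_of_nonneg_right
        (Real.rpow_le_rpow ht.le hat (by linarith)) ((norm_nonneg _).trans hP)).trans h2
      calc _ ≤ t * P := (kFunctional_apply_le ht.le w).trans (mul_le_mul_of_nonneg_left hP ht.le)
        _ = t ^ θ' * (t ^ (1 - θ') * P) := by
          rw [← mul_assoc, ← Real.rpow_add ht]; simp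
        _ ≤ _ := mul_le_mul_of_nonneg_left h4 (by positivity)

end Interp
end QuasiPar

namespace QuasiPar
variable {E F : Type*} [NormedAddCommGroup E] [NormedSpace ℝ E]
  [NormedAddCommGroup F] [NormedSpace ℝ F]

/-! ### The time-weighted spaces `BC_{1-μ}` -/

section BC

variable {μ T : ℝ} {f g : ℝ → E}

/-- Since `0 ^ (1 - μ) = 0`, the weighted function vanishes at `0` whatever `f 0` is, so the limit
condition becomes continuity at `0`, and boundedness follows by compactness. -/
theorem isBC_iff (hμ : μ < 1) (hT : 0 < T) :
    IsBC μ T f ↔ ContinuousOn (fun t : ℝ => t ^ (1 - μ) • f t) (Icc 0 T) := by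
  have h0 : (0 : ℝ) ^ (1 - μ) = 0 := Real.zero_rpow (by linarith)
  constructor
  · intro h t ht
    rcases ht.1.eq_or_lt with rfl | ht0
    · have h1 : Tendsto (fun t : ℝ => t ^ (1 - μ) • f t) (𝓝[>] 0) (𝓝 0) :=
        tendsto_zero_iff_norm_tendsto_zero.2 h.vanishing
      have h2 : ContinuousWithinAt (fun t : ℝ => t ^ (1 - μ) • f t) (Ioi 0) 0 := by
        simpa [ContinuousWithinAt, h0] using h1
      exact (continuousWithinAt_Ioi_iff_Ici.1 h2).mono fun s hs => hs.1
    · have h1 : ContinuousWithinAt (fun t : ℝ => t ^ (1 - μ) • f t) (Ioc 0 T) t :=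
        (Real.continuousAt_rpow_const _ _ (Or.inl ht0.ne')).continuousWithinAt.smul
          (h.continuousOn t ⟨ht0, ht.2⟩)
      refine h1.mono_of_mem_nhdsWithin ?_
      filter_upwards [self_mem_nhdsWithin, mem_nhdsWithin_of_mem_nhds (Ioi_mem_nhds ht0)]
        with s hs hs' using ⟨hs', hs.2⟩
  · intro h
    refine ⟨?_, ?_, ?_⟩
    · have h1 : ContinuousOn (fun t : ℝ => t ^ (μ - 1) • t ^ (1 - μ) • f t) (Ioc 0 T) :=
        ContinuousOn.smul (fun t ht => (Real.continuousAt_rpow_const _ _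
          (Or.inl ht.1.ne')).continuousWithinAt) (h.mono Ioc_subset_Icc_self)
      refine h1.congr fun t ht => ?_
      simp only
      rw [smul_smul, ← Real.rpow_add ht.1]; simp
    · obtain ⟨C, hC⟩ := isCompact_Icc.exists_bound_of_continuousOn h
      exact ⟨C, fun t ht => hC t ⟨ht.1.le, ht.2⟩⟩
    · have h1 : Tendsto _ _ _ := (h 0 ⟨le_rfl, hT.le⟩)
      have h2 := (h1.mono_left (nhdsWithin_mono 0 (Ioc_subset_Icc_self (a := 0) (b := T)))).norm
      rw [nhdsWithin_Ioc_eq_nhdsGT hT] at h2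
      simpa [h0] using h2

theorem IsBC.congr (hT : 0 < T) (hf : IsBC μ T f) (h : EqOn g f (Ioc 0 T)) : IsBC μ T g where
  continuousOn := hf.continuousOn.congr h
  bounded := hf.bounded.imp fun C hC t ht => by rw [h ht]; exact hC t ht
  vanishing := hf.vanishing.congr' <| by
    filter_upwards [Ioc_mem_nhdsGT hT] with t ht
    rw [h ht]

theorem IsBC.mono (hf : IsBC μ T f) {T' : ℝ} (h : T' ≤ T) : IsBC μ T' f where
  continuousOn := hf.continuousOn.mono (Ioc_subset_Ioc_right h)
  bounded := hf.bounded.imp fun _ hC t ht => hC t ⟨ht.1, ht.2.trans h⟩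
  vanishing := hf.vanishing

theorem IsBC.add (hμ : μ < 1) (hT : 0 < T) (hf : IsBC μ T f) (hg : IsBC μ T g) :
    IsBC μ T (fun t => f t + g t) := by
  rw [isBC_iff hμ hT] at *
  exact (hf.add hg).congr fun t _ => smul_add _ _ _

theorem IsBC.clm_comp (hμ : μ < 1) (hT : 0 < T) (hf : IsBC μ T f) (B : E →L[ℝ] F) :
    IsBC μ T (fun t => B (f t)) := by
  rw [isBC_iff hμ hT] at *
  simpa only [Function.comp_def, map_smul] using B.continuous.comp_continuousOn hf

theorem IsBC.smul (hμ : μ < 1) (hT : 0 < T) (hf : IsBC μ T f) {φ : ℝ → ℝ}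
    (hφ : ContinuousOn φ (Icc 0 T)) : IsBC μ T (fun t => φ t • f t) := by
  rw [isBC_iff hμ hT] at *
  refine (hφ.smul hf).congr fun t _ => ?_
  exact smul_comm _ _ _

theorem IsBC.const_smul (hμ : μ < 1) (hT : 0 < T) (hf : IsBC μ T f) (c : ℝ) :
    IsBC μ T (fun t => c • f t) :=
  hf.smul hμ hT continuousOn_const

theorem IsBC.neg (hμ : μ < 1) (hT : 0 < T) (hf : IsBC μ T f) : IsBC μ T (fun t => -f t) := by
  simpa using hf.const_smul hμ hT (-1)

theorem IsBC.sub (hμ : μ < 1) (hT : 0 < T) (hf : IsBC μ T f) (hg : IsBC μ T g) :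
    IsBC μ T (fun t => f t - g t) := by
  simpa only [sub_eq_add_neg] using hf.add hμ hT (hg.neg hμ hT)

theorem isBC_of_continuousOn (hμ : μ < 1) (hT : 0 < T) (hf : ContinuousOn f (Icc 0 T)) :
    IsBC μ T f :=
  (isBC_iff hμ hT).2 <| ContinuousOn.smul
    (Real.continuous_rpow_const (by linarith)).continuousOn hf

theorem isBC_const (hμ : μ < 1) (hT : 0 < T) (c : E) : IsBC μ T (fun _ => c) :=
  isBC_of_continuousOn hμ hT continuousOn_const

theorem IsBC.exists_norm_le (hf : IsBC μ T f) :
    ∃ C, ∀ t ∈ Ioc 0 T, ‖f t‖ ≤ C * t ^ (μ - 1) := by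
  obtain ⟨C, hC⟩ := hf.bounded
  refine ⟨C, fun t ht => ?_⟩
  have h1 := hC t ht
  have h2 := Real.rpow_pos_of_pos ht.1 (μ - 1)
  rw [norm_smul, Real.norm_of_nonneg (Real.rpow_nonneg ht.1.le _)] at h1
  have h3 : t ^ (μ - 1) * t ^ (1 - μ) = 1 := by rw [← Real.rpow_add ht.1]; simp
  calc ‖f t‖ = t ^ (μ - 1) * t ^ (1 - μ) * ‖f t‖ := by rw [h3, one_mul]
    _ = t ^ (1 - μ) * ‖f t‖ * t ^ (μ - 1) := by ring
    _ ≤ _ := mul_le_mul_of_nonneg_right h1 h2.le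

theorem IsBC.intervalIntegrable (hμ : 0 < μ) (hf : IsBC μ T f) {t : ℝ} (ht : t ∈ Icc 0 T) :
    IntervalIntegrable f MeasureTheory.volume 0 t := by
  obtain ⟨C, hC⟩ := hf.exists_norm_le
  have h1 : IntervalIntegrable (fun t : ℝ => C * t ^ (μ - 1)) MeasureTheory.volume 0 t :=
    (intervalIntegral.intervalIntegrable_rpow' (by linarith)).const_mul C
  rw [intervalIntegrable_iff_integrableOn_Ioc_of_le ht.1] at *
  refine MeasureTheory.Integrable.mono' h1
    ((hf.continuousOn.mono (Ioc_subset_Ioc_right ht.2)).aestronglyMeasurable measurableSet_Ioc) ?_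
  filter_upwards [MeasureTheory.ae_restrict_mem measurableSet_Ioc] with s hs
  exact hC s ⟨hs.1, hs.2.trans ht.2⟩

theorem IsBC.continuousOn_integral (hμ : 0 < μ) (hT : 0 ≤ T) (hf : IsBC μ T f) :
    ContinuousOn (fun t => ∫ s in (0 : ℝ)..t, f s) (Icc 0 T) := by
  have := intervalIntegral.continuousOn_primitive_interval'
    (hf.intervalIntegrable hμ ⟨hT, le_rfl⟩) left_mem_uIcc
  rwa [uIcc_of_le hT] at this

theorem IsBC.tendsto_integral (hμ : 0 < μ) (hT : 0 < T) (hf : IsBC μ T f) :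
    Tendsto (fun t => ∫ s in (0 : ℝ)..t, f s) (𝓝[>] 0) (𝓝 0) := by
  have h1 : Tendsto _ _ _ := hf.continuousOn_integral hμ hT.le 0 ⟨le_rfl, hT.le⟩
  have h2 := h1.mono_left (nhdsWithin_mono 0 (Ioc_subset_Icc_self (a := 0) (b := T)))
  rw [nhdsWithin_Ioc_eq_nhdsGT hT] at h2
  simpa using h2

theorem IsBC.norm_integral_le {ν G : ℝ} (hν : 0 < ν) {t : ℝ} (ht : 0 ≤ t)
    (h : ∀ s ∈ Ioc 0 t, s ^ (1 - ν) * ‖f s‖ ≤ G) : ‖∫ s in (0 : ℝ)..t, f s‖ ≤ t ^ ν * G / ν := by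
  have h1 : IntervalIntegrable (fun s : ℝ => G * s ^ (ν - 1)) MeasureTheory.volume 0 t :=
    (intervalIntegral.intervalIntegrable_rpow' (by linarith)).const_mul G
  refine (intervalIntegral.norm_integral_le_of_norm_le ht (.of_forall fun s hs => ?_) h1).trans
    (le_of_eq ?_)
  · have h2 := h s hs
    have h3 : s ^ (ν - 1) * s ^ (1 - ν) = 1 := by rw [← Real.rpow_add hs.1]; simp
    have h4 := Real.rpow_pos_of_pos hs.1 (ν - 1)
    calc ‖f s‖ = s ^ (ν - 1) * (s ^ (1 - ν) * ‖f s‖) := by rw [← mul_assoc, h3, one_mul]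
      _ ≤ s ^ (ν - 1) * G := mul_le_mul_of_nonneg_left h2 h4.le
      _ = _ := mul_comm _ _
  · rw [intervalIntegral.integral_const_mul, integral_rpow (Or.inl (by linarith)), sub_add_cancel,
      Real.zero_rpow hν.ne']
    ring

theorem IsBC.shift (hμ : μ < 1) (hf : IsBC μ T f) {a : ℝ} (ha : 0 < a) (haT : a < T) :
    IsBC μ (T - a) (fun s => f (a + s)) :=
  isBC_of_continuousOn hμ (by linarith) <| hf.continuousOn.comp (by fun_prop)
    fun s hs => ⟨by linarith [hs.1], by linarith [hs.2]⟩

/-- Two functions that fit together at time `a` can be glued within `BC_{1-μ}`. -/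
theorem IsBC.glue (hμ : μ < 1) {a : ℝ} (ha : 0 < a) (haT : a < T) (hf : IsBC μ a f)
    (hg : ContinuousOn g (Ioc 0 (T - a))) (hfg : Tendsto g (𝓝[>] 0) (𝓝 (f a))) :
    IsBC μ T (fun t => if t ≤ a then f t else g (t - a)) := by
  rw [isBC_iff hμ ha] at hf
  rw [isBC_iff hμ (ha.trans haT), ← Icc_union_Icc_eq_Icc ha.le haT.le]
  refine ContinuousOn.union_of_isClosed (hf.congr fun t ht => ?_) ?_ isClosed_Icc isClosed_Icc
  · simp [ht.2]
  -- The value `g 0` is arbitrary; replacing it by the limit `f a` makes `g` continuous up to `0`.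
  · have h1 : ContinuousOn (fun t => Function.update g 0 (f a) (t - a)) (Icc a T) := by
      intro t ht
      have hm : MapsTo (fun t => t - a) (Icc a T) (Icc 0 (T - a)) := fun s hs =>
        ⟨by linarith [hs.1], by linarith [hs.2]⟩
      refine ContinuousWithinAt.comp (t := Icc 0 (T - a)) (f := fun t => t - a)
        (g := Function.update g 0 (f a)) ?_ (by fun_prop) hm
      rcases ht.1.eq_or_lt with rfl | h
      · rw [sub_self, continuousWithinAt_update_same]
        refine hfg.mono_left (nhdsWithin_mono _ ?_)
        rintro s ⟨hs, hs'⟩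
        exact lt_of_le_of_ne hs.1 (Ne.symm hs')
      · have h0 : 0 < t - a := by linarith
        refine (continuousWithinAt_update_of_ne h0.ne').2 ?_
        refine (hg (t - a) ⟨h0, by linarith [ht.2]⟩).mono_of_mem_nhdsWithin ?_
        filter_upwards [self_mem_nhdsWithin, mem_nhdsWithin_of_mem_nhds (Ioi_mem_nhds h0)]
          with r hr hr' using ⟨hr', hr.2⟩
    refine (ContinuousOn.smul (fun t ht => (Real.continuousAt_rpow_const t (1 - μ)
      (Or.inl (ha.trans_le ht.1).ne')).continuousWithinAt) h1).congr fun t ht => ?_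
    refine congrArg _ ?_
    rcases ht.1.eq_or_lt with rfl | h
    · simp
    · have h0 : t - a ≠ 0 := by linarith
      simp only [if_neg h.not_ge, Function.update_of_ne h0]

variable [CompleteSpace E]

theorem IsBC.hasDerivWithinAt_integral (hμ : 0 < μ) (hf : IsBC μ T f) {t : ℝ}
    (ht : t ∈ Ioc 0 T) :
    HasDerivWithinAt (fun t => ∫ s in (0 : ℝ)..t, f s) (f t) (Ioc 0 T) t := by
  -- Freezing `f` after time `T` makes it continuous on both sides of `T`, so the two-sided
  -- fundamental theorem also covers the endpoint.
  set h : ℝ → E := fun s => f (min s T) with hh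
  have hT : 0 < T := ht.1.trans_le ht.2
  have hc : ContinuousOn h (Ioi 0) := hf.continuousOn.comp (by fun_prop)
    fun s hs => ⟨lt_min hs hT, min_le_right _ _⟩
  have heq : ∀ s ∈ Icc (0 : ℝ) T, h s = f s := fun s hs => by simp [hh, hs.2]
  have hint : ∀ t' ∈ Icc (0 : ℝ) T, ∫ s in (0 : ℝ)..t', h s = ∫ s in (0 : ℝ)..t', f s := by
    intro t' ht'
    refine intervalIntegral.integral_congr fun s hs => heq s ?_
    rw [uIcc_of_le ht'.1] at hs
    exact ⟨hs.1, hs.2.trans ht'.2⟩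
  have hii : IntervalIntegrable h MeasureTheory.volume 0 t := by
    refine (hf.intervalIntegrable hμ ⟨ht.1.le, ht.2⟩).congr fun s hs => ?_
    rw [uIoc_of_le ht.1.le] at hs
    exact (heq s ⟨hs.1.le, hs.2.trans ht.2⟩).symm
  have hd := intervalIntegral.integral_hasDerivAt_right hii
    (hc.stronglyMeasurableAtFilter isOpen_Ioi t ht.1) (hc.continuousAt (Ioi_mem_nhds ht.1))
  rw [heq t ⟨ht.1.le, ht.2⟩] at hd
  exact hd.hasDerivWithinAt.congr (fun s hs => (hint s ⟨hs.1.le, hs.2⟩).symm)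
    (hint t ⟨ht.1.le, ht.2⟩).symm

theorem IsBC.eq_add_integral (hμ : 0 < μ) (hf : IsBC μ T f) {u : ℝ → E} {x : E}
    (hu : ContinuousOn u (Ioc 0 T)) (h0 : Tendsto u (𝓝[>] 0) (𝓝 x))
    (hd : ∀ t ∈ Ioo 0 T, HasDerivAt u (f t) t) {t : ℝ} (ht : t ∈ Ioc 0 T) :
    u t = x + ∫ s in (0 : ℝ)..t, f s := by
  have hc : ContinuousOn (Function.update u 0 x) (Icc 0 t) := by
    intro s hs
    rcases hs.1.eq_or_lt with rfl | hs0
    · rw [continuousWithinAt_update_same]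
      refine h0.mono_left (nhdsWithin_mono _ ?_)
      rintro s ⟨hs, hs'⟩
      exact lt_of_le_of_ne hs.1 (Ne.symm hs')
    · refine (continuousWithinAt_update_of_ne hs0.ne').2 ?_
      refine ((hu s ⟨hs0, hs.2.trans ht.2⟩).mono (Ioc_subset_Ioc_right ht.2)).mono_of_mem_nhdsWithin
        ?_
      filter_upwards [self_mem_nhdsWithin, mem_nhdsWithin_of_mem_nhds (Ioi_mem_nhds hs0)]
        with r hr hr' using ⟨hr', hr.2⟩
  have := intervalIntegral.integral_eq_sub_of_hasDerivAt_of_le ht.1.le hc (f' := f)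
    (fun s hs => ((hd s ⟨hs.1, hs.2.trans_le ht.2⟩).congr_of_eventuallyEq <| by
      filter_upwards [Ioi_mem_nhds hs.1] with r (hr : 0 < r)
      rw [Function.update_of_ne hr.ne'])) (hf.intervalIntegrable hμ ⟨ht.1.le, ht.2⟩)
  rw [this, Function.update_of_ne ht.1.ne', Function.update_self]
  abel

end BC
end QuasiPar

namespace QuasiPar
variable {E₀ E₁ : Type*} [NormedAddCommGroup E₀] [NormedSpace ℝ E₀]
  [NormedAddCommGroup E₁] [NormedSpace ℝ E₁]

/-! ### The linear problem in integrated form -/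

/-- `v` is the `E₁`-valued function underlying a solution in `𝔼_{1,μ}([0, T])` of `u' + B u = g`,
`u(0) = x`; the equation is written in integrated form. -/
structure IsMild (i : E₁ →L[ℝ] E₀) (μ T : ℝ) (B : E₁ →L[ℝ] E₀) (x : E₀) (g : ℝ → E₀)
    (v : ℝ → E₁) : Prop where
  bc : IsBC μ T v
  bc_rhs : IsBC μ T g
  eq : ∀ t ∈ Ioc 0 T, i (v t) = x + ∫ s in (0 : ℝ)..t, (g s - B (v s))

namespace IsMild

variable {i B : E₁ →L[ℝ] E₀} {μ T : ℝ} {x x' : E₀} {g g' : ℝ → E₀} {v v' : ℝ → E₁}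

theorem mono (h : IsMild i μ T B x g v) {T' : ℝ} (hT : T' ≤ T) : IsMild i μ T' B x g v :=
  ⟨h.bc.mono hT, h.bc_rhs.mono hT, fun t ht => h.eq t ⟨ht.1, ht.2.trans hT⟩⟩

theorem bc_deriv (hμ : μ < 1) (hT : 0 < T) (h : IsMild i μ T B x g v) :
    IsBC μ T (fun t => g t - B (v t)) :=
  h.bc_rhs.sub hμ hT (h.bc.clm_comp hμ hT B)

theorem congr (hT : 0 < T) (h : IsMild i μ T B x g v) (hg : EqOn g' g (Ioc 0 T))
    (hv : EqOn v' v (Ioc 0 T)) : IsMild i μ T B x g' v' := by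
  refine ⟨h.bc.congr hT hv, h.bc_rhs.congr hT hg, fun t ht => ?_⟩
  rw [hv ht, h.eq t ht]
  congr 1
  refine intervalIntegral.integral_congr_uIoo fun s hs => ?_
  rw [uIoo_of_le ht.1.le] at hs
  have hs' : s ∈ Ioc 0 T := ⟨hs.1, hs.2.le.trans ht.2⟩
  simp only [hg hs', hv hs']

theorem const (hμ : μ < 1) (hT : 0 < T) (y : E₁) :
    IsMild i μ T B (i y) (fun _ => B y) (fun _ => y) :=
  ⟨isBC_const hμ hT y, isBC_const hμ hT _, fun t _ => by simp⟩

theorem sub (hμ : μ ∈ Ioo (0 : ℝ) 1) (hT : 0 < T) (h : IsMild i μ T B x g v)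
    (h' : IsMild i μ T B x' g' v') :
    IsMild i μ T B (x - x') (fun t => g t - g' t) (fun t => v t - v' t) := by
  refine ⟨h.bc.sub hμ.2 hT h'.bc, h.bc_rhs.sub hμ.2 hT h'.bc_rhs, fun t ht => ?_⟩
  have h1 := (h.bc_deriv hμ.2 hT).intervalIntegrable hμ.1 ⟨ht.1.le, ht.2⟩
  have h2 := (h'.bc_deriv hμ.2 hT).intervalIntegrable hμ.1 ⟨ht.1.le, ht.2⟩
  rw [map_sub, h.eq t ht, h'.eq t ht, add_sub_add_comm, ← intervalIntegral.integral_sub h1 h2]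
  congr 1
  refine intervalIntegral.integral_congr fun s _ => ?_
  simp only [map_sub]
  abel

theorem smul (hμ : μ < 1) (hT : 0 < T) (h : IsMild i μ T B x g v) (c : ℝ) :
    IsMild i μ T B (c • x) (fun t => c • g t) (fun t => c • v t) := by
  refine ⟨h.bc.const_smul hμ hT c, h.bc_rhs.const_smul hμ hT c, fun t ht => ?_⟩
  rw [map_smul, h.eq t ht, smul_add, ← intervalIntegral.integral_smul]
  congr 1
  refine intervalIntegral.integral_congr fun s _ => ?_
  simp only [map_smul, smul_sub]

theorem add (hμ : μ ∈ Ioo (0 : ℝ) 1) (hT : 0 < T) (h : IsMild i μ T B x g v)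
    (h' : IsMild i μ T B x' g' v') :
    IsMild i μ T B (x + x') (fun t => g t + g' t) (fun t => v t + v' t) := by
  simpa using h.sub hμ hT (h'.smul hμ.2 hT (-1))

theorem tendsto (hμ : μ ∈ Ioo (0 : ℝ) 1) (hT : 0 < T) (h : IsMild i μ T B x g v) :
    Tendsto (fun t => i (v t)) (𝓝[>] 0) (𝓝 x) := by
  have h1 := ((h.bc_deriv hμ.2 hT).tendsto_integral hμ.1 hT).const_add x
  rw [add_zero] at h1
  refine h1.congr' ?_
  filter_upwards [Ioc_mem_nhdsGT hT] with t ht using (h.eq t ht).symm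

/-- Gluing at time `a` when both the solution and the right-hand side are continuous there. -/
theorem glue (hμ : μ ∈ Ioo (0 : ℝ) 1) {a : ℝ} (ha : 0 < a) (haT : a < T)
    (h : IsMild i μ a B x g v) (h' : IsMild i μ (T - a) B (i (v a)) g' v')
    (hv : Tendsto v' (𝓝[>] 0) (𝓝 (v a))) (hg : Tendsto g' (𝓝[>] 0) (𝓝 (g a))) :
    IsMild i μ T B x (fun t => if t ≤ a then g t else g' (t - a))
      (fun t => if t ≤ a then v t else v' (t - a)) := by
  have hT : 0 < T := ha.trans haT
  have hTa : 0 < T - a := sub_pos.2 haT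
  have bcv := h.bc.glue hμ.2 ha haT h'.bc.continuousOn hv
  have bcg := h.bc_rhs.glue hμ.2 ha haT h'.bc_rhs.continuousOn hg
  refine ⟨bcv, bcg, fun t ht => ?_⟩
  have key : ∀ t ∈ Ioc 0 a, ∫ s in (0 : ℝ)..t, ((if s ≤ a then g s else g' (s - a)) -
      B (if s ≤ a then v s else v' (s - a))) = ∫ s in (0 : ℝ)..t, (g s - B (v s)) := by
    intro t ht
    refine intervalIntegral.integral_congr fun s hs => ?_
    rw [uIcc_of_le ht.1.le] at hs
    simp only [if_pos (hs.2.trans ht.2)]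
  rcases le_or_gt t a with hta | hta
  · rw [if_pos hta, key t ⟨ht.1, hta⟩]
    exact h.eq t ⟨ht.1, hta⟩
  · have ii := @IsBC.intervalIntegrable _ _ _ μ T _ hμ.1 (bcg.sub hμ.2 hT (bcv.clm_comp hμ.2 hT B))
    have ia := ii (t := a) ⟨ha.le, haT.le⟩
    rw [if_neg hta.not_ge, ← intervalIntegral.integral_add_adjacent_intervals ia
      (ia.symm.trans (ii ⟨ht.1.le, ht.2⟩)), key a ⟨ha, le_rfl⟩, ← add_assoc,
      ← h.eq a ⟨ha, le_rfl⟩, h'.eq (t - a) ⟨sub_pos.2 hta, by linarith [ht.2]⟩]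
    congr 1
    have h1 : ∫ s in a..t, (g' (s - a) - B (v' (s - a))) =
        ∫ s in (0 : ℝ)..(t - a), (g' s - B (v' s)) := by
      rw [intervalIntegral.integral_comp_sub_right (fun s => g' s - B (v' s)), sub_self]
    rw [← h1]
    refine intervalIntegral.integral_congr_uIoo fun s hs => ?_
    rw [uIoo_of_le hta.le] at hs
    simp only [if_neg hs.1.not_ge]

theorem shift (hμ : μ ∈ Ioo (0 : ℝ) 1) {a : ℝ} (ha : 0 < a) (haT : a < T)
    (h : IsMild i μ T B x g v) :
    IsMild i μ (T - a) B (i (v a)) (fun s => g (a + s)) (fun s => v (a + s)) := by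
  have hT : 0 < T := ha.trans haT
  refine ⟨h.bc.shift hμ.2 ha haT, h.bc_rhs.shift hμ.2 ha haT, fun t ht => ?_⟩
  have ii := @IsBC.intervalIntegrable _ _ _ μ T _ hμ.1 (h.bc_deriv hμ.2 hT)
  have ia := ii (t := a) ⟨ha.le, haT.le⟩
  have iat := ii (t := a + t) ⟨by linarith [ht.1], by linarith [ht.2]⟩
  rw [h.eq (a + t) ⟨by linarith [ht.1], by linarith [ht.2]⟩, h.eq a ⟨ha, haT.le⟩,
    ← intervalIntegral.integral_add_adjacent_intervals ia (ia.symm.trans iat), ← add_assoc]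
  congr 1
  rw [intervalIntegral.integral_comp_add_left (fun s => g s - B (v s)), add_zero]

variable [CompleteSpace E₀]

theorem hasDerivWithinAt (hμ : μ ∈ Ioo (0 : ℝ) 1) (h : IsMild i μ T B x g v) {t : ℝ}
    (ht : t ∈ Ioc 0 T) :
    HasDerivWithinAt (fun t => i (v t)) (g t - B (v t)) (Ioc 0 T) t :=
  (((h.bc_deriv hμ.2 (ht.1.trans_le ht.2)).hasDerivWithinAt_integral hμ.1 ht).const_add x).congr
    h.eq (h.eq t ht)

theorem of_hasDerivAt (hμ : μ ∈ Ioo (0 : ℝ) 1) (hv : IsBC μ T v) (hg : IsBC μ T g)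
    (h0 : Tendsto (fun t => i (v t)) (𝓝[>] 0) (𝓝 x))
    (hd : ∀ t ∈ Ioo 0 T, HasDerivAt (fun t => i (v t)) (g t - B (v t)) t) :
    IsMild i μ T B x g v :=
  ⟨hv, hg, fun _ ht => (hg.sub hμ.2 (ht.1.trans_le ht.2)
    (hv.clm_comp hμ.2 (ht.1.trans_le ht.2) B)).eq_add_integral hμ.1
      (i.continuous.comp_continuousOn hv.continuousOn) h0 hd ht⟩

theorem isMaxRegFun (hμ : μ ∈ Ioo (0 : ℝ) 1) (hT : 0 < T) (h : IsMild i μ T B x g v)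
    {u : ℝ → E₀} (hu0 : u 0 = x) (hu : ∀ t ∈ Ioc 0 T, u t = i (v t)) :
    IsMaxRegFun i μ T u v (fun t => g t - B (v t)) where
  lift t ht := (hu t ht).symm
  hasDeriv t ht := (h.hasDerivWithinAt hμ ht).congr hu (hu t ht)
  bc := (h.bc.clm_comp hμ.2 hT i).congr hT hu
  bc_deriv := h.bc_deriv hμ.2 hT
  bc_lift := h.bc
  trace := by
    rw [hu0]
    refine (h.tendsto hμ hT).congr' ?_
    filter_upwards [Ioc_mem_nhdsGT hT] with t ht using (hu t ht).symm

variable [CompleteSpace E₁]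

/-- The integral of a solution solves the integrated problem, with initial value zero. -/
theorem integral (hμ : μ ∈ Ioo (0 : ℝ) 1) (hT : 0 < T) (h : IsMild i μ T B x g v) :
    IsMild i μ T B 0 (fun t => x + ∫ s in (0 : ℝ)..t, g s) (fun t => ∫ s in (0 : ℝ)..t, v s) := by
  refine ⟨isBC_of_continuousOn hμ.2 hT (h.bc.continuousOn_integral hμ.1 hT.le),
    isBC_of_continuousOn hμ.2 hT
      (continuousOn_const.add (h.bc_rhs.continuousOn_integral hμ.1 hT.le)), fun t ht => ?_⟩
  rw [← i.intervalIntegral_comp_comm (h.bc.intervalIntegrable hμ.1 ⟨ht.1.le, ht.2⟩), zero_add]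
  refine intervalIntegral.integral_congr_uIoo fun s hs => ?_
  rw [uIoo_of_le ht.1.le] at hs
  have hs' : s ∈ Icc 0 T := ⟨hs.1.le, hs.2.le.trans ht.2⟩
  have h1 := h.bc_rhs.intervalIntegrable hμ.1 hs'
  have h2 := h.bc.intervalIntegrable hμ.1 hs'
  have h3 := (h.bc.clm_comp hμ.2 hT B).intervalIntegrable hμ.1 hs'
  rw [h.eq s ⟨hs.1, hs'.2⟩, intervalIntegral.integral_sub h1 h3, B.intervalIntegral_comp_comm h2]
  abel

theorem apply_eq (hμ : μ ∈ Ioo (0 : ℝ) 1) (h : IsMild i μ T B x g v) {t : ℝ} (ht : t ∈ Ioc 0 T) :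
    i (v t) = x + (∫ s in (0 : ℝ)..t, g s) - B (∫ s in (0 : ℝ)..t, v s) := by
  have hT := ht.1.trans_le ht.2
  have ht' : t ∈ Icc 0 T := ⟨ht.1.le, ht.2⟩
  rw [h.eq t ht, intervalIntegral.integral_sub (h.bc_rhs.intervalIntegrable hμ.1 ht')
    ((h.bc.clm_comp hμ.2 hT B).intervalIntegrable hμ.1 ht'),
    B.intervalIntegral_comp_comm (h.bc.intervalIntegrable hμ.1 ht')]
  abel

end IsMild

variable {i B : E₁ →L[ℝ] E₀} {μ T : ℝ}

theorem IsMaxRegFun.isMild [CompleteSpace E₀] (hμ : μ ∈ Ioo (0 : ℝ) 1) (hT : 0 < T) {u u' : ℝ → E₀}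
    {v : ℝ → E₁} (h : IsMaxRegFun i μ T u v u') :
    IsMild i μ T B (u 0) (fun t => u' t + B (v t)) v := by
  refine .of_hasDerivAt hμ h.bc_lift (h.bc_deriv.add hμ.2 hT (h.bc_lift.clm_comp hμ.2 hT B)) ?_ ?_
  · refine h.trace.congr' ?_
    filter_upwards [Ioc_mem_nhdsGT hT] with t ht using (h.lift t ht).symm
  · intro t ht
    rw [add_sub_cancel_right]
    refine ((h.hasDeriv t ⟨ht.1, ht.2.le⟩).hasDerivAt (Ioc_mem_nhds ht.1 ht.2)).congr_of_eventuallyEq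
      ?_
    filter_upwards [Ioc_mem_nhds ht.1 ht.2] with s hs using h.lift s hs

/-- Solvability of the linear problem on `[0, T]`, in integrated form. -/
structure MildSolvable (i : E₁ →L[ℝ] E₀) (μ T : ℝ) (B : E₁ →L[ℝ] E₀) : Prop where
  exists_sol : ∀ x ∈ interpSpace i μ, ∀ g, IsBC μ T g → ∃ v, IsMild i μ T B x g v
  unique : ∀ v, IsMild i μ T B 0 (fun _ => 0) v → ∀ t ∈ Ioc 0 T, v t = 0

theorem exists_mildSolvable [CompleteSpace E₀] (hi : Function.Injective i)
    (hμ : μ ∈ Ioo (0 : ℝ) 1) (hB : B ∈ maxRegClass i μ) : ∃ T > 0, MildSolvable i μ T B := by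
  obtain ⟨T, hT, h⟩ := hB
  refine ⟨T, hT, fun x hx g hg => ?_, fun v hv t ht => ?_⟩
  · obtain ⟨u, v, u', hu, rfl, he⟩ := (h g hg x hx).1
    exact ⟨v, (hu.isMild (B := B) hμ hT).congr hT (fun t ht => (he t ht).symm) fun _ _ => rfl⟩
  · have h0 : (0 : E₀) ∈ interpSpace i μ := by
      simpa using apply_mem_interpSpace (i := i) hμ.2 0
    have hz : ∀ v : ℝ → E₁, IsMild i μ T B 0 (fun _ => 0) v →
        IsLinearSolution i μ T B (fun _ => 0) 0 (fun t => if t = 0 then 0 else i (v t)) :=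
      fun v hv => ⟨v, _, hv.isMaxRegFun hμ hT (if_pos rfl) fun t ht => if_neg ht.1.ne',
        if_pos rfl, fun t _ => by simp⟩
    have hc : IsMild i μ T B 0 (fun _ => 0) (fun _ => 0) := by
      simpa using IsMild.const (i := i) (B := B) hμ.2 hT 0
    have h1 := (h _ (isBC_const hμ.2 hT 0) 0 h0).2 _ _ (hz v hv) (hz _ hc) ⟨ht.1.le, ht.2⟩
    simp only [if_neg ht.1.ne', map_zero] at h1
    exact hi (by rw [h1, map_zero])

end QuasiPar

/-! ### Weighted functions as elements of `C([0, T], E)`, and the maximal regularity estimate -/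

namespace QuasiPar
section Weight

variable {E : Type*} [NormedAddCommGroup E] [NormedSpace ℝ E] {μ T : ℝ}

/-- The function `t ^ (μ - 1) γ(t)` on `(0, T]`. -/
noncomputable def unweight (μ : ℝ) (hT : 0 ≤ T) (γ : C(Icc (0 : ℝ) T, E)) : ℝ → E :=
  fun t => t ^ (μ - 1) • γ (projIcc 0 T hT t)

theorem rpow_smul_rpow_smul {t : ℝ} (ht : 0 < t) (a : ℝ) (e : E) :
    t ^ (1 - a) • t ^ (a - 1) • e = e := by
  rw [smul_smul, ← Real.rpow_add ht]; simp

theorem rpow_smul_rpow_smul' {t : ℝ} (ht : 0 < t) (a : ℝ) (e : E) :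
    t ^ (a - 1) • t ^ (1 - a) • e = e := by
  rw [smul_smul, ← Real.rpow_add ht]; simp

theorem isBC_unweight (hμ : μ < 1) (hT : 0 < T) {γ : C(Icc (0 : ℝ) T, E)}
    (h0 : γ ⟨0, le_rfl, hT.le⟩ = 0) : IsBC μ T (unweight μ hT.le γ) := by
  rw [isBC_iff hμ hT]
  refine ((γ.continuous.comp (continuous_projIcc (h := hT.le))).continuousOn (s := Icc 0 T)).congr fun t ht => ?_
  rcases ht.1.eq_or_lt with rfl | h
  · simp [unweight, h0]
  · exact rpow_smul_rpow_smul h μ _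

theorem norm_unweight_le (hT : 0 < T) (γ : C(Icc (0 : ℝ) T, E)) {t : ℝ} (ht : 0 < t) :
    t ^ (1 - μ) * ‖unweight μ hT.le γ t‖ ≤ ‖γ‖ := by
  have := γ.norm_coe_le_norm (projIcc 0 T hT.le t)
  rwa [← rpow_smul_rpow_smul ht μ (γ _), norm_smul,
    Real.norm_of_nonneg (Real.rpow_nonneg ht.le _)] at this

theorem IsBC.exists_unweight (hμ : μ < 1) (hT : 0 < T) {f : ℝ → E} (hf : IsBC μ T f) :
    ∃ γ : C(Icc (0 : ℝ) T, E), γ ⟨0, le_rfl, hT.le⟩ = 0 ∧ (∀ t, γ t = (t : ℝ) ^ (1 - μ) • f t) ∧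
      EqOn (unweight μ hT.le γ) f (Ioc 0 T) := by
  refine ⟨⟨fun t => (t : ℝ) ^ (1 - μ) • f t, ?_⟩, ?_, fun t => rfl, fun t ht => ?_⟩
  · exact continuousOn_iff_continuous_domRestrict.1 ((isBC_iff hμ hT).1 hf)
  · change (0 : ℝ) ^ (1 - μ) • f 0 = 0
    rw [Real.zero_rpow (by linarith), zero_smul]
  · simp only [unweight, projIcc_of_mem hT.le ⟨ht.1.le, ht.2⟩]
    exact rpow_smul_rpow_smul' ht.1 μ _

end Weight

/-- The closed graph theorem for a linear relation that is a function on a closed subspace. -/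
theorem exists_bound_of_closed_relation {E F : Type*} [NormedAddCommGroup E] [NormedSpace ℝ E]
    [NormedAddCommGroup F] [NormedSpace ℝ F] [CompleteSpace F] (X : Submodule ℝ E)
    [CompleteSpace X] (R : E → F → Prop) (hex : ∀ γ ∈ X, ∃ φ, R γ φ)
    (huniq : ∀ γ φ φ', R γ φ → R γ φ' → φ = φ')
    (hadd : ∀ γ φ γ' φ', R γ φ → R γ' φ' → R (γ + γ') (φ + φ'))
    (hsmul : ∀ (c : ℝ) γ φ, R γ φ → R (c • γ) (c • φ))
    (hclosed : ∀ (u : ℕ → E) (w : ℕ → F) (γ : E) (φ : F), γ ∈ X → (∀ n, R (u n) (w n)) →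
      Tendsto u atTop (𝓝 γ) → Tendsto w atTop (𝓝 φ) → R γ φ) :
    ∃ M > 0, ∀ γ ∈ X, ∀ φ, R γ φ → ‖φ‖ ≤ M * ‖γ‖ := by
  have hsol : ∀ γ : X, ∃ φ, R γ φ := fun γ => hex γ γ.2
  choose S hS using hsol
  let S' : X →ₗ[ℝ] F :=
    { toFun := S
      map_add' := fun γ γ' => huniq _ _ _ (hS (γ + γ')) (hadd _ _ _ _ (hS γ) (hS γ'))
      map_smul' := fun c γ => huniq _ _ _ (hS (c • γ)) (hsmul c _ _ (hS γ)) }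
  have hcont : Continuous S' := S'.continuous_of_seq_closed_graph fun u γ φ hu hφ =>
    huniq _ _ _ (hclosed (fun n => u n) _ γ φ γ.2 (fun n => hS (u n))
      ((continuous_subtype_val.tendsto _).comp hu) hφ) (hS γ)
  let S'' : X →L[ℝ] F := ⟨S', hcont⟩
  refine ⟨‖S''‖ + 1, by positivity, fun γ hγ φ hφ => ?_⟩
  rw [huniq _ _ _ hφ (hS ⟨γ, hγ⟩)]
  refine (S''.le_opNorm ⟨γ, hγ⟩).trans ?_
  exact mul_le_mul_of_nonneg_right (by linarith) (norm_nonneg _)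

variable {E₀ E₁ : Type*} [NormedAddCommGroup E₀] [NormedSpace ℝ E₀]
  [NormedAddCommGroup E₁] [NormedSpace ℝ E₁] {i B : E₁ →L[ℝ] E₀} {μ T : ℝ}

/-- The integrated equation is stable under convergence in the weighted spaces. -/
theorem IsMild.of_tendsto (hμ : μ ∈ Ioo (0 : ℝ) 1) (hT : 0 < T) {x : E₀}
    {γ : ℕ → C(Icc (0 : ℝ) T, E₀)} {γ' : C(Icc (0 : ℝ) T, E₀)}
    {φ : ℕ → C(Icc (0 : ℝ) T, E₁)} {φ' : C(Icc (0 : ℝ) T, E₁)}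
    (hγ0 : γ' ⟨0, le_rfl, hT.le⟩ = 0) (hφ0 : φ' ⟨0, le_rfl, hT.le⟩ = 0)
    (hγ : Tendsto γ atTop (𝓝 γ')) (hφ : Tendsto φ atTop (𝓝 φ'))
    (h : ∀ n, IsMild i μ T B x (unweight μ hT.le (γ n)) (unweight μ hT.le (φ n))) :
    IsMild i μ T B x (unweight μ hT.le γ') (unweight μ hT.le φ') := by
  have hbv := isBC_unweight hμ.2 hT hφ0
  have hbg := isBC_unweight hμ.2 hT hγ0
  refine ⟨hbv, hbg, fun t ht => ?_⟩
  have ii := (hbg.sub hμ.2 hT (hbv.clm_comp hμ.2 hT B)).intervalIntegrable hμ.1 ⟨ht.1.le, ht.2⟩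
  have hint : Tendsto (fun n => ∫ s in (0 : ℝ)..t,
      (unweight μ hT.le (γ n) s - B (unweight μ hT.le (φ n) s))) atTop
      (𝓝 (∫ s in (0 : ℝ)..t, (unweight μ hT.le γ' s - B (unweight μ hT.le φ' s)))) := by
    rw [tendsto_iff_norm_sub_tendsto_zero] at hγ hφ ⊢
    have hz : Tendsto (fun n => t ^ μ * (‖γ n - γ'‖ + ‖B‖ * ‖φ n - φ'‖) / μ) atTop (𝓝 0) := by
      simpa using ((hγ.add (hφ.const_mul ‖B‖)).const_mul (t ^ μ)).div_const μ
    refine squeeze_zero (fun _ => norm_nonneg _) (fun n => ?_) hz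
    have iin := ((h n).bc_deriv hμ.2 hT).intervalIntegrable hμ.1 ⟨ht.1.le, ht.2⟩
    rw [← intervalIntegral.integral_sub iin ii]
    refine IsBC.norm_integral_le hμ.1 ht.1.le fun s hs => ?_
    have h1 := norm_unweight_le (μ := μ) hT (γ n - γ') hs.1
    have h2 := norm_unweight_le (μ := μ) hT (φ n - φ') hs.1
    have h3 : unweight μ hT.le (γ n) s - B (unweight μ hT.le (φ n) s) -
        (unweight μ hT.le γ' s - B (unweight μ hT.le φ' s)) =
        unweight μ hT.le (γ n - γ') s - B (unweight μ hT.le (φ n - φ') s) := by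
      simp only [unweight, ContinuousMap.sub_apply, smul_sub, map_sub]
      abel
    rw [h3]
    have h4 := Real.rpow_nonneg hs.1.le (1 - μ)
    have h5 := (norm_sub_le (unweight μ hT.le (γ n - γ') s)
      (B (unweight μ hT.le (φ n - φ') s))).trans
        (add_le_add_right (B.le_opNorm (unweight μ hT.le (φ n - φ') s)) _)
    calc _ ≤ s ^ (1 - μ) * (‖unweight μ hT.le (γ n - γ') s‖ +
          ‖B‖ * ‖unweight μ hT.le (φ n - φ') s‖) := mul_le_mul_of_nonneg_left h5 h4
      _ = s ^ (1 - μ) * ‖unweight μ hT.le (γ n - γ') s‖ +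
          ‖B‖ * (s ^ (1 - μ) * ‖unweight μ hT.le (φ n - φ') s‖) := by ring
      _ ≤ _ := add_le_add h1 (mul_le_mul_of_nonneg_left h2 (norm_nonneg _))
  have hlhs : Tendsto (fun n => i (unweight μ hT.le (φ n) t)) atTop
      (𝓝 (i (unweight μ hT.le φ' t))) := by
    have h1 : Tendsto (fun n => φ n (projIcc 0 T hT.le t)) atTop
        (𝓝 (φ' (projIcc 0 T hT.le t))) :=
      ((continuous_eval_const _).tendsto φ').comp hφ
    exact (i.continuous.tendsto _).comp (h1.const_smul (t ^ (μ - 1)))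
  refine tendsto_nhds_unique hlhs ((hint.const_add x).congr fun n => ?_)
  exact ((h n).eq t ht).symm

variable [CompleteSpace E₀] [CompleteSpace E₁]

/-- Uniqueness is assumed on `[0, T]` only, so a null solution on `[0, τ]` must be continued. The
solution `ζ` started at `i (v τ)` need not be `E₁`-continuous at its initial time, so `v` itself
cannot be glued to it. The integral `∫ v` can: its continuation `∫₀^τ v + ∫ ζ` is continuous in
`E₁`. The glued function vanishes by uniqueness on `[0, T]`, and then `i (v t) = -B (∫₀^t v) = 0`.
-/
theorem MildSolvable.eq_zero (hi : Function.Injective i) (hμ : μ ∈ Ioo (0 : ℝ) 1)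
    (h : MildSolvable i μ T B) {τ : ℝ} (hτ : 0 < τ) (hτT : τ ≤ T) {v : ℝ → E₁}
    (hv : IsMild i μ τ B 0 (fun _ => 0) v) : ∀ t ∈ Ioc 0 τ, v t = 0 := by
  rcases hτT.eq_or_lt with rfl | hlt
  · exact h.unique v hv
  have hT : 0 < T := hτ.trans hlt
  have hTτ : 0 < T - τ := sub_pos.2 hlt
  have hV : IsMild i μ τ B 0 (fun _ => 0) (fun t => ∫ s in (0 : ℝ)..t, v s) :=
    (hv.integral hμ hτ).congr hτ (fun t _ => by simp) fun _ _ => rfl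
  obtain ⟨ζ, hζ⟩ := h.exists_sol (i (v τ)) (apply_mem_interpSpace hμ.2 _) (fun _ => 0)
    (isBC_const hμ.2 hT 0)
  have hτeq := hv.apply_eq hμ (t := τ) ⟨hτ, le_rfl⟩
  have hζ' := hζ.mono (sub_le_self T hτ.le)
  -- The right-hand side produced is `B (∫₀^τ v) + i (v τ)`, which is zero by `hτeq`.
  have hz : IsMild i μ (T - τ) B (i (∫ s in (0 : ℝ)..τ, v s)) (fun _ => 0)
      (fun t => (∫ s in (0 : ℝ)..τ, v s) + ∫ s in (0 : ℝ)..t, ζ s) := by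
    have := (IsMild.const (i := i) (B := B) hμ.2 hTτ (∫ s in (0 : ℝ)..τ, v s)).add hμ hTτ
      (hζ'.integral hμ hTτ)
    rw [add_zero] at this
    exact this.congr hTτ (fun t _ => by simp [hτeq]) fun _ _ => rfl
  have hzt : Tendsto (fun t => (∫ s in (0 : ℝ)..τ, v s) + ∫ s in (0 : ℝ)..t, ζ s) (𝓝[>] 0)
      (𝓝 (∫ s in (0 : ℝ)..τ, v s)) := by
    simpa using (hζ'.bc.tendsto_integral hμ.1 hTτ).const_add (∫ s in (0 : ℝ)..τ, v s)
  have hglue := hV.glue hμ hτ hlt hz hzt tendsto_const_nhds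
  have h0 := h.unique _ (hglue.congr hT (fun t _ => by simp) fun _ _ => rfl)
  intro t ht
  have h1 := h0 t ⟨ht.1, ht.2.trans hτT⟩
  rw [if_pos ht.2] at h1
  have h2 := hv.apply_eq hμ ht
  rw [h1] at h2
  exact hi (by simpa using h2)

theorem MildSolvable.eqOn (hi : Function.Injective i) (hμ : μ ∈ Ioo (0 : ℝ) 1)
    (h : MildSolvable i μ T B) {τ : ℝ} (hτ : 0 < τ) (hτT : τ ≤ T) {x : E₀} {g : ℝ → E₀}
    {v v' : ℝ → E₁} (hv : IsMild i μ τ B x g v) (hv' : IsMild i μ τ B x g v') :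
    EqOn v v' (Ioc 0 τ) := fun t ht => by
  have h1 := hv.sub hμ hτ hv'
  simp only [sub_self] at h1
  exact sub_eq_zero.1 (h.eq_zero hi hμ hτ hτT h1 t ht)

/-- Continuous maximal regularity as an estimate, uniform on the intervals `[0, τ]`, `τ ≤ T`. -/
theorem MildSolvable.exists_bound (hi : Function.Injective i) (hμ : μ ∈ Ioo (0 : ℝ) 1)
    (hT : 0 < T) (h : MildSolvable i μ T B) :
    ∃ M > 0, ∀ τ ∈ Ioc 0 T, ∀ g v, IsMild i μ τ B 0 g v → ∀ G,
      (∀ s ∈ Ioc 0 τ, s ^ (1 - μ) * ‖g s‖ ≤ G) → ∀ s ∈ Ioc 0 τ, s ^ (1 - μ) * ‖v s‖ ≤ M * G := by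
  let ev : C(Icc (0 : ℝ) T, E₀) →L[ℝ] E₀ := ContinuousMap.evalCLM ℝ ⟨0, le_rfl, hT.le⟩
  obtain ⟨X, hXc, hXmem⟩ : ∃ X : Submodule ℝ C(Icc (0 : ℝ) T, E₀), CompleteSpace X ∧
      ∀ γ, γ ∈ X ↔ γ ⟨0, le_rfl, hT.le⟩ = 0 :=
    ⟨LinearMap.ker ev.toLinearMap, ContinuousLinearMap.completeSpace_ker ev, fun _ => Iff.rfl⟩
  -- The relation is the graph of the solution operator with zero initial value, acting between the
  -- weighted functions that vanish at `0`.
  obtain ⟨M, hM, hbound⟩ := exists_bound_of_closed_relation X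
    (fun (γ : C(Icc (0 : ℝ) T, E₀)) (φ : C(Icc (0 : ℝ) T, E₁)) => φ ⟨0, le_rfl, hT.le⟩ = 0 ∧
      IsMild i μ T B 0 (unweight μ hT.le γ) (unweight μ hT.le φ))
    (fun γ hγ => by
      have h0 : (0 : E₀) ∈ interpSpace i μ := by
        simpa using apply_mem_interpSpace (i := i) hμ.2 0
      obtain ⟨v, hv⟩ := h.exists_sol 0 h0 _ (isBC_unweight hμ.2 hT ((hXmem γ).1 hγ))
      obtain ⟨φ, hφ0, -, hφ⟩ := hv.bc.exists_unweight hμ.2 hT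
      exact ⟨φ, hφ0, hv.congr hT (fun _ _ => rfl) hφ⟩)
    (fun γ φ φ' hφ hφ' => by
      ext ⟨t, ht⟩
      rcases ht.1.eq_or_lt with rfl | ht0
      · rw [hφ.1, hφ'.1]
      · have := h.eqOn hi hμ hT le_rfl hφ.2 hφ'.2 ⟨ht0, ht.2⟩
        simp only [unweight, projIcc_of_mem hT.le ht] at this
        exact smul_right_injective E₁ (Real.rpow_pos_of_pos ht0 (μ - 1)).ne' this)
    (fun γ φ γ' φ' hφ hφ' => by
      refine ⟨by simp [hφ.1, hφ'.1], ?_⟩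
      have := hφ.2.add hμ hT hφ'.2
      rw [add_zero] at this
      exact this.congr hT (fun t _ => by simp [unweight]) fun t _ => by simp [unweight])
    (fun c γ φ hφ => by
      refine ⟨by simp [hφ.1], ?_⟩
      have := hφ.2.smul hμ.2 hT c
      rw [smul_zero] at this
      exact this.congr hT (fun t _ => by simp [unweight, smul_comm c])
        fun t _ => by simp [unweight, smul_comm c])
    (fun u w γ φ hγ hR hu hw => by
      have h0 : φ ⟨0, le_rfl, hT.le⟩ = 0 :=
        tendsto_nhds_unique (((continuous_eval_const
          (⟨0, le_rfl, hT.le⟩ : Icc (0 : ℝ) T)).tendsto φ).comp hw)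
          (tendsto_const_nhds.congr fun n => (hR n).1.symm)
      exact ⟨h0, IsMild.of_tendsto hμ hT ((hXmem γ).1 hγ) h0 hu hw fun n => (hR n).2⟩)
  refine ⟨M, hM, fun τ hτ g v hv G hG s hs => ?_⟩
  -- Freezing the weighted right-hand side after `τ` does not increase its sup norm. By uniqueness
  -- on `[0, τ]` the solution for the extension restricts to `v`, so the constant of `[0, T]` serves
  -- every `τ`.
  have hcl : ContinuousOn (fun t : ℝ => (min t τ) ^ (1 - μ) • g (min t τ)) (Icc 0 T) :=
    ((isBC_iff hμ.2 hτ.1).1 hv.bc_rhs).comp (f := fun t => min t τ) (by fun_prop)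
      fun t ht => ⟨le_min ht.1 hτ.1.le, min_le_right _ _⟩
  let γ : C(Icc (0 : ℝ) T, E₀) := ⟨_, continuousOn_iff_continuous_domRestrict.1 hcl⟩
  have hγ0 : γ ⟨0, le_rfl, hT.le⟩ = 0 := by
    simp [γ, hτ.1.le, Real.zero_rpow (by linarith [hμ.2] : (1 - μ) ≠ 0)]
  have hG0 : 0 ≤ G := (mul_nonneg (Real.rpow_nonneg hs.1.le _) (norm_nonneg _)).trans (hG s hs)
  have hγG : ‖γ‖ ≤ G := by
    refine (ContinuousMap.norm_le _ hG0).2 fun ⟨t, ht⟩ => ?_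
    change ‖(min t τ) ^ (1 - μ) • g (min t τ)‖ ≤ G
    rcases ht.1.eq_or_lt with rfl | ht0
    · simpa [hτ.1.le, Real.zero_rpow (by linarith [hμ.2] : (1 - μ) ≠ 0)]
    · rw [norm_smul, Real.norm_of_nonneg (Real.rpow_nonneg (le_min ht.1 hτ.1.le) _)]
      exact hG _ ⟨lt_min ht0 hτ.1, min_le_right _ _⟩
  have h0 : (0 : E₀) ∈ interpSpace i μ := by
    simpa using apply_mem_interpSpace (i := i) hμ.2 0
  obtain ⟨v', hv'⟩ := h.exists_sol 0 h0 _ (isBC_unweight hμ.2 hT hγ0)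
  obtain ⟨φ, hφ0, -, hφ⟩ := hv'.bc.exists_unweight hμ.2 hT
  have hm := hv'.congr hT (fun _ _ => rfl) hφ
  have hm' := (hm.mono hτ.2).congr hτ.1 (g' := g) (fun t ht => by
    have ht' : t ∈ Icc 0 T := ⟨ht.1.le, ht.2.trans hτ.2⟩
    simp only [unweight, projIcc_of_mem hT.le ht']
    change _ = t ^ (μ - 1) • ((min t τ) ^ (1 - μ) • g (min t τ))
    rw [min_eq_left ht.2, rpow_smul_rpow_smul' ht.1]) fun _ _ => rfl
  rw [h.eqOn hi hμ hτ.1 hτ.2 hv hm' hs]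
  refine (norm_unweight_le hT _ hs.1).trans
    ((hbound γ ((hXmem γ).2 hγ0) φ ⟨hφ0, hm⟩).trans ?_)
  exact mul_le_mul_of_nonneg_left hγG hM.le

end QuasiPar

namespace QuasiPar
variable {E₀ E₁ : Type*} [NormedAddCommGroup E₀] [NormedSpace ℝ E₀] [CompleteSpace E₀]
  [NormedAddCommGroup E₁] [NormedSpace ℝ E₁] {i B : E₁ →L[ℝ] E₀} {μ T : ℝ}

/-! ### Weighted estimates for the linear problem -/

/-- Multiplication by `s / t` removes the initial value and leaves the value at `s = t` unchanged.
The product rule adds only the term `t⁻¹ w`, measured in `E₀`; this is the source of smoothing. -/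
theorem IsMild.smul_id_div (hμ : μ ∈ Ioo (0 : ℝ) 1) {t : ℝ} (ht : 0 < t) {x : E₀} {g : ℝ → E₀}
    {v : ℝ → E₁} (hv : IsMild i μ t B x g v) :
    IsMild i μ t B 0 (fun s => t⁻¹ • i (v s) + (s / t) • g s) (fun s => (s / t) • v s) := by
  have hc : ContinuousOn (fun s : ℝ => s / t) (Icc 0 t) := by fun_prop
  refine .of_hasDerivAt hμ (hv.bc.smul hμ.2 ht hc)
    (((hv.bc.clm_comp hμ.2 ht i).const_smul hμ.2 ht _).add hμ.2 ht
      (hv.bc_rhs.smul hμ.2 ht hc)) ?_ fun s hs => ?_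
  · have h1 : Tendsto (fun s : ℝ => s / t) (𝓝[>] 0) (𝓝 0) := by
      have : Tendsto (fun s : ℝ => s / t) (𝓝 0) (𝓝 (0 / t)) := tendsto_id.div_const t
      rw [zero_div] at this
      exact this.mono_left nhdsWithin_le_nhds
    simpa using h1.smul (hv.tendsto hμ ht)
  · have h1 := (hv.hasDerivWithinAt hμ ⟨hs.1, hs.2.le⟩).hasDerivAt (Ioc_mem_nhds hs.1 hs.2)
    have h2 := ((hasDerivAt_id s).div_const t).smul h1
    simp only [map_smul]
    refine h2.congr_deriv ?_
    simp only [smul_sub, id, one_div]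
    abel

variable [CompleteSpace E₁]

/-- The integral of `v - y` has zero initial value and right-hand side `x - i y + ∫ (g - B y)`,
which is bounded in `E₀` by `H`. Maximal regularity bounds `∫ (v - y)` in `E₁`, and the integrated
equation expresses `i (v t) - i y` through these quantities alone. Only integrals of `g` enter,
which is why any weight `ν > 0` is allowed. -/
theorem MildSolvable.exists_bound_sub (hi : Function.Injective i) (hμ : μ ∈ Ioo (0 : ℝ) 1)
    (hT : 0 < T) (h : MildSolvable i μ T B) {ν : ℝ} (hν : 0 < ν) :
    ∃ C > 0, ∀ t ∈ Ioc 0 T, ∀ x g v, IsMild i μ t B x g v → ∀ G,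
      (∀ s ∈ Ioc 0 t, s ^ (1 - ν) * ‖g s‖ ≤ G) →
      ∀ y, ‖i (v t) - i y‖ ≤ C * (‖x - i y‖ + t * ‖y‖ + t ^ ν * G) := by
  obtain ⟨M, hM, hbound⟩ := h.exists_bound hi hμ hT
  refine ⟨(1 + ‖B‖ * M) * (1 + ‖B‖ + 1 / ν), by positivity, fun t ht x g v hv G hG y => ?_⟩
  have htt : t ∈ Ioc 0 t := ⟨ht.1, le_rfl⟩
  have hG0 : 0 ≤ G := (mul_nonneg (Real.rpow_nonneg ht.1.le _) (norm_nonneg _)).trans (hG t htt)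
  have hm := hv.sub hμ ht.1 (IsMild.const (i := i) (B := B) hμ.2 ht.1 y)
  set H := ‖x - i y‖ + t * (‖B‖ * ‖y‖) + t ^ ν * G / ν with hH
  have hH0 : 0 ≤ H := by have := ht.1; positivity
  have hint : ∀ s ∈ Ioc 0 t, ‖x - i y + ∫ r in (0 : ℝ)..s, (g r - B y)‖ ≤ H := by
    intro s hs
    rw [intervalIntegral.integral_sub (hv.bc_rhs.intervalIntegrable hμ.1 ⟨hs.1.le, hs.2⟩) (by simp),
      intervalIntegral.integral_const, sub_zero]
    have h1 : ‖∫ r in (0 : ℝ)..s, g r‖ ≤ t ^ ν * G / ν :=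
      (IsBC.norm_integral_le hν hs.1.le fun r hr => hG r ⟨hr.1, hr.2.trans hs.2⟩).trans <| by
        gcongr
        · exact hs.1.le
        · exact hs.2
    have h2 : ‖s • B y‖ ≤ t * (‖B‖ * ‖y‖) := by
      rw [norm_smul, Real.norm_of_nonneg hs.1.le]
      exact mul_le_mul hs.2 (B.le_opNorm y) (norm_nonneg _) ht.1.le
    have h3 := norm_add_le (x - i y) ((∫ r in (0 : ℝ)..s, g r) - s • B y)
    have h4 := norm_sub_le (∫ r in (0 : ℝ)..s, g r) (s • B y)
    linarith
  have hI : ‖∫ s in (0 : ℝ)..t, (v s - y)‖ ≤ M * H := by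
    -- The weight is bounded by its value at `s = t`, where the factor `t ^ (1 - μ)` cancels from
    -- both sides.
    have h1 := hbound t ht _ _ (hm.integral hμ ht.1) (t ^ (1 - μ) * H) (fun s hs =>
      mul_le_mul (Real.rpow_le_rpow hs.1.le hs.2 (by linarith [hμ.2])) (hint s hs)
        (norm_nonneg _) (Real.rpow_nonneg ht.1.le _)) t htt
    have h2 := Real.rpow_pos_of_pos ht.1 (1 - μ)
    rw [mul_left_comm] at h1
    exact le_of_mul_le_mul_left h1 h2
  have heq := hm.apply_eq hμ htt
  rw [map_sub] at heq
  rw [heq]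
  have h1 := norm_sub_le (x - i y + ∫ r in (0 : ℝ)..t, (g r - B y))
    (B (∫ s in (0 : ℝ)..t, (v s - y)))
  have h2 := (B.le_opNorm (∫ s in (0 : ℝ)..t, (v s - y))).trans
    (mul_le_mul_of_nonneg_left hI (norm_nonneg _))
  have h3 := hint t htt
  have h4 : H ≤ (1 + ‖B‖ + 1 / ν) * (‖x - i y‖ + t * ‖y‖ + t ^ ν * G) := by
    have ht0 := ht.1
    have a1 : 0 ≤ (‖B‖ + 1 / ν) * ‖x - i y‖ := by positivity
    have a2 : 0 ≤ (1 + 1 / ν) * (t * ‖y‖) := by positivity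
    have a3 : 0 ≤ (1 + ‖B‖) * (t ^ ν * G) := by positivity
    have a4 : t ^ ν * G / ν = 1 / ν * (t ^ ν * G) := by ring
    rw [hH, a4]
    linarith
  calc _ ≤ H + ‖B‖ * (M * H) := by linarith
    _ = (1 + ‖B‖ * M) * H := by ring
    _ ≤ (1 + ‖B‖ * M) * ((1 + ‖B‖ + 1 / ν) * (‖x - i y‖ + t * ‖y‖ + t ^ ν * G)) :=
      mul_le_mul_of_nonneg_left h4 (by positivity)
    _ = _ := by ring

/-- Maximal regularity is applied to `(s / t) (v - y)`. Its right-hand side `t⁻¹ (v - y) + (s / t)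
(g - B y)` is of size `P / t` in `E₀`, by `MildSolvable.exists_bound_sub` for the first term and `s
‖g s‖ ≤ t ^ ν G` for the second. -/
theorem MildSolvable.exists_bound_smoothing (hi : Function.Injective i) (hμ : μ ∈ Ioo (0 : ℝ) 1)
    (hT : 0 < T) (h : MildSolvable i μ T B) {ν : ℝ} (hν : 0 < ν) :
    ∃ C > 0, ∀ t ∈ Ioc 0 T, ∀ x g v, IsMild i μ t B x g v → ∀ G,
      (∀ s ∈ Ioc 0 t, s ^ (1 - ν) * ‖g s‖ ≤ G) →
      ∀ y, t * ‖v t‖ ≤ C * (‖x - i y‖ + t * ‖y‖ + t ^ ν * G) := by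
  obtain ⟨M, hM, hbound⟩ := h.exists_bound hi hμ hT
  obtain ⟨C, hC, hsub⟩ := h.exists_bound_sub hi hμ hT hν
  refine ⟨M * (C + 1 + ‖B‖) + 1, by positivity, fun t ht x g v hv G hG y => ?_⟩
  have htt : t ∈ Ioc 0 t := ⟨ht.1, le_rfl⟩
  have hG0 : 0 ≤ G := (mul_nonneg (Real.rpow_nonneg ht.1.le _) (norm_nonneg _)).trans (hG t htt)
  set P := ‖x - i y‖ + t * ‖y‖ + t ^ ν * G with hP
  have ht0 := ht.1
  have hP0 : 0 ≤ P := by positivity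
  have hm := (hv.sub hμ ht.1 (IsMild.const (i := i) (B := B) hμ.2 ht.1 y)).smul_id_div hμ ht.1
  have h1 := hbound t ht _ _ hm (t ^ (-μ) * ((C + 1 + ‖B‖) * P)) (fun s hs => ?_) t htt
  · rw [div_self ht0.ne', one_smul, sub_eq_add_neg (1 : ℝ) μ, Real.rpow_add ht0, Real.rpow_one] at h1
    have h2 : t ^ (-μ) * (t * ‖v t - y‖) ≤ t ^ (-μ) * (M * ((C + 1 + ‖B‖) * P)) := by linarith
    replace h2 := le_of_mul_le_mul_left h2 (Real.rpow_pos_of_pos ht0 (-μ))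
    have h3 : ‖v t‖ ≤ ‖v t - y‖ + ‖y‖ := by simpa using norm_add_le (v t - y) y
    have h4 : t * ‖y‖ ≤ P := by
      have : 0 ≤ t ^ ν * G := by positivity
      have := norm_nonneg (x - i y)
      linarith
    have h5 := mul_le_mul_of_nonneg_left h3 ht0.le
    linarith
  · have hs0 := hs.1
    have hw : s ^ (1 - μ) ≤ t ^ (1 - μ) := Real.rpow_le_rpow hs0.le hs.2 (by linarith [hμ.2])
    have hw0 : 0 ≤ s ^ (1 - μ) := Real.rpow_nonneg hs0.le _
    have hst : s / t ≤ 1 := (div_le_one ht0).2 hs.2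
    have a1 : ‖t⁻¹ • i (v s - y)‖ ≤ t⁻¹ * (C * P) := by
      rw [norm_smul, Real.norm_of_nonneg (by positivity), map_sub]
      refine mul_le_mul_of_nonneg_left ((hsub s ⟨hs0, hs.2.trans ht.2⟩ x g v (hv.mono hs.2) G
        (fun r hr => hG r ⟨hr.1, hr.2.trans hs.2⟩) y).trans ?_) (by positivity)
      have : s ^ ν ≤ t ^ ν := Real.rpow_le_rpow hs0.le hs.2 hν.le
      rw [hP]
      gcongr
      exact hs.2
    have a2 : ‖(s / t) • (g s - B y)‖ ≤ t⁻¹ * ((1 + ‖B‖) * P) := by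
      rw [norm_smul, Real.norm_of_nonneg (by positivity)]
      have b1 : s * ‖g s‖ ≤ t ^ ν * G := by
        have : s = s ^ ν * s ^ (1 - ν) := by rw [← Real.rpow_add hs0]; simp
        calc s * ‖g s‖ = s ^ ν * (s ^ (1 - ν) * ‖g s‖) := by
              rw [← mul_assoc, ← this]
          _ ≤ t ^ ν * G := mul_le_mul (Real.rpow_le_rpow hs0.le hs.2 hν.le) (hG s hs)
            (by positivity) (by positivity)
      have b2 : s * ‖B y‖ ≤ ‖B‖ * (t * ‖y‖) := by
        calc s * ‖B y‖ ≤ t * (‖B‖ * ‖y‖) := mul_le_mul hs.2 (B.le_opNorm y) (norm_nonneg _) ht0.le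
          _ = _ := by ring
      have b3 : s * ‖g s - B y‖ ≤ (1 + ‖B‖) * P := by
        have c1 := mul_le_mul_of_nonneg_left (norm_sub_le (g s) (B y)) hs0.le
        have c2 : 0 ≤ t * ‖y‖ := by positivity
        have c3 : 0 ≤ t ^ ν * G := by positivity
        have c4 := norm_nonneg (x - i y)
        have c5 := norm_nonneg B
        have c6 : ‖B‖ * (t * ‖y‖) ≤ ‖B‖ * P := mul_le_mul_of_nonneg_left (by linarith) c5
        linarith
      calc s / t * ‖g s - B y‖ = t⁻¹ * (s * ‖g s - B y‖) := by ring
        _ ≤ _ := mul_le_mul_of_nonneg_left b3 (by positivity)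
    have a3 := (norm_add_le (t⁻¹ • i (v s - y)) ((s / t) • (g s - B y))).trans (add_le_add a1 a2)
    calc _ ≤ t ^ (1 - μ) * (t⁻¹ * (C * P) + t⁻¹ * ((1 + ‖B‖) * P)) :=
          mul_le_mul hw a3 (norm_nonneg _) (by positivity)
      _ = t ^ (-μ) * (t * t⁻¹) * ((C + 1 + ‖B‖) * P) := by
        rw [sub_eq_add_neg, Real.rpow_add ht0, Real.rpow_one]; ring
      _ = _ := by rw [mul_inv_cancel₀ ht0.ne', mul_one]

/-- Regularity of the linear problem in the weighted space attached to `E_ν`, for every `ν`. -/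
theorem MildSolvable.exists_estimate (hi : Function.Injective i) (hμ : μ ∈ Ioo (0 : ℝ) 1)
    (hT : 0 < T) (h : MildSolvable i μ T B) {ν : ℝ} (hν : ν ∈ Ioo (0 : ℝ) 1) :
    ∃ C > 0, ∀ τ ∈ Ioc 0 T, ∀ x ∈ interpSpace i ν, ∀ g v, IsMild i μ τ B x g v → ∀ G,
      (∀ s ∈ Ioc 0 τ, s ^ (1 - ν) * ‖g s‖ ≤ G) → ∀ t ∈ Ioc 0 τ,
      t ^ (1 - ν) * ‖v t‖ ≤ C * (interpNorm i ν x + G) ∧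
      interpNorm i ν (i (v t)) ≤ C * (interpNorm i ν x + G) := by
  obtain ⟨C₁, hC₁, h₁⟩ := h.exists_bound_sub hi hμ hT hν.1
  obtain ⟨C₂, hC₂, h₂⟩ := h.exists_bound_smoothing hi hμ hT hν.1
  refine ⟨C₁ + 1 + C₂, by positivity, fun τ hτ x hx g v hv G hG t ht => ?_⟩
  have ht0 := ht.1
  have htT : t ∈ Ioc 0 T := ⟨ht0, ht.2.trans hτ.2⟩
  have hvt := hv.mono ht.2
  have hGt : ∀ s ∈ Ioc 0 t, s ^ (1 - ν) * ‖g s‖ ≤ G := fun s hs => hG s ⟨hs.1, hs.2.trans ht.2⟩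
  have hG0 : 0 ≤ G := (mul_nonneg (Real.rpow_nonneg ht0.le _) (norm_nonneg _)).trans (hG t ht)
  set P := interpNorm i ν x + G with hP
  have hP0 : 0 ≤ P := add_nonneg (interpNorm_nonneg _) hG0
  have hK : ∀ s > 0, kFunctional i s x + s ^ ν * G ≤ s ^ ν * P := fun s hs => by
    rw [hP, mul_add]
    exact add_le_add_left (kFunctional_le_interpNorm hν.1.le hx hs) _
  have hsm : t ^ (1 - ν) * ‖v t‖ ≤ C₂ * P := by
    have h3 : t * ‖v t‖ ≤ C₂ * (t ^ ν * P) :=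
      (le_mul_kFunctional_add hC₂ (h₂ t htT x g v hvt G hGt)).trans
        (mul_le_mul_of_nonneg_left (hK t ht0) hC₂.le)
    have h4 : t = t ^ ν * t ^ (1 - ν) := by rw [← Real.rpow_add ht0]; simp
    have h5 : t ^ ν * (t ^ (1 - ν) * ‖v t‖) ≤ t ^ ν * (C₂ * P) := by
      rw [← mul_assoc, ← h4]; linarith
    exact le_of_mul_le_mul_left h5 (Real.rpow_pos_of_pos ht0 _)
  have hC : C₂ * P ≤ (C₁ + 1 + C₂) * P := mul_le_mul_of_nonneg_right (by linarith) hP0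
  refine ⟨hsm.trans hC, interpNorm_le fun s hs => ?_⟩
  have hs0 : 0 < s := hs
  -- For `s ≤ t` the smoothing bound controls `K(s, v t) ≤ s ‖v t‖`. For `s ≥ t` an element `y`
  -- approximating the initial value `x` at scale `s` also approximates `v t`, and the infimum over
  -- `y` is taken.
  rcases le_total s t with hst | hst
  · have h3 : s ^ (1 - ν) * ‖v t‖ ≤ C₂ * P := (mul_le_mul_of_nonneg_right
      (Real.rpow_le_rpow hs0.le hst (by linarith [hν.2])) (norm_nonneg _)).trans hsm
    have h4 : s = s ^ ν * s ^ (1 - ν) := by rw [← Real.rpow_add hs0]; simp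
    calc _ ≤ s * ‖v t‖ := kFunctional_apply_le hs0.le _
      _ = s ^ ν * (s ^ (1 - ν) * ‖v t‖) := by rw [← mul_assoc, ← h4]
      _ ≤ _ := mul_le_mul_of_nonneg_left (h3.trans hC) (by positivity)
  · have h3 : kFunctional i s (i (v t)) ≤ (C₁ + 1) * (s ^ ν * P) := by
      refine (le_mul_kFunctional_add (by positivity) fun y => ?_).trans
        (mul_le_mul_of_nonneg_left (hK s hs0) (by positivity))
      refine (kFunctional_le hs0.le _ y).trans ?_
      have h4 := h₁ t htT x g v hvt G hGt y
      have h5 : ‖x - i y‖ + t * ‖y‖ + t ^ ν * G ≤ ‖x - i y‖ + s * ‖y‖ + s ^ ν * G := by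
        have := Real.rpow_le_rpow ht0.le hst hν.1.le
        gcongr
      have h6 := mul_le_mul_of_nonneg_left h5 hC₁.le
      have h7 := norm_nonneg (x - i y)
      have h8 : 0 ≤ s ^ ν * G := by positivity
      linarith
    refine h3.trans ?_
    have h4 : 0 ≤ C₂ * (s ^ ν * P) := by positivity
    linarith

end QuasiPar

namespace QuasiPar
variable {E₀ E₁ : Type*} [NormedAddCommGroup E₀] [NormedSpace ℝ E₀]
  [NormedAddCommGroup E₁] [NormedSpace ℝ E₁]
  {i : E₁ →L[ℝ] E₀} {μ β : ℝ} {V : Set E₀} {A : E₀ → E₁ →L[ℝ] E₀} {F₁ F₂ : E₀ → E₀} {y : E₁}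

/-! ### The nonlinearity near an equilibrium -/

/-- The right-hand side of `w' + A(y) w = remainder w`, the equation for the deviation
`w = u - y` from the equilibrium `y`. -/
noncomputable def remainder (i : E₁ →L[ℝ] E₀) (A : E₀ → E₁ →L[ℝ] E₀) (F₁ F₂ : E₀ → E₀) (y w : E₁) :
    E₀ :=
  F₁ (i (y + w)) + F₂ (i (y + w)) - A (i (y + w)) (y + w) + A (i y) w

theorem IsEquilibrium.remainder_zero (hy : IsEquilibrium i V A F₁ F₂ y) :
    remainder i A F₁ F₂ y 0 = 0 := by
  simp [remainder, hy.2]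

/-- What matters is the form of the bound: the top-order difference `‖w₁ - w₂‖` is multiplied by the
small quantity `|w₁|_{E_μ}`, and everything else involves lower-order norms of the difference. -/
theorem exists_remainder_sub_le (hμ : μ ∈ Ioo (0 : ℝ) 1) (hV : IsOpenInInterp i μ V)
    (hH1 : HypH1 i μ V A F₁) (hH2 : HypH2 i μ V F₂ β) (hy : i y ∈ V) :
    ∃ r₀ ∈ Ioc (0 : ℝ) 1, ∃ L ≥ (0 : ℝ), ∃ C > (0 : ℝ), ∃ (m : ℕ) (b ρ : Fin m → ℝ),
      (∀ j, b j ∈ Icc μ β ∧ 0 ≤ ρ j ∧ (ρ j * (β - μ) + (b j - μ)) / (1 - μ) ≤ 1) ∧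
      (∀ w, interpNorm i μ (i w) ≤ r₀ → i (y + w) ∈ V) ∧
      ∀ w₁ w₂, interpNorm i μ (i w₁) ≤ r₀ → interpNorm i μ (i w₂) ≤ r₀ →
        ‖remainder i A F₁ F₂ y w₁ - remainder i A F₁ F₂ y w₂‖ ≤
          L * interpNorm i μ (i (w₁ - w₂)) * (1 + ‖y‖ + ‖w₂‖) +
          L * interpNorm i μ (i w₁) * ‖w₁ - w₂‖ +
          C * ∑ j, (1 + interpNorm i β (i (y + w₁)) ^ ρ j + interpNorm i β (i (y + w₂)) ^ ρ j) *
            interpNorm i (b j) (i (w₁ - w₂)) := by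
  obtain ⟨rV, hrV, hopen⟩ := hV.2 _ hy
  obtain ⟨r₁, hr₁, L, hL⟩ := hH1.lipschitz _ hy
  obtain ⟨hβ, m, b, ρ, hbρ, hF₂⟩ := hH2
  obtain ⟨C, hC, hF₂⟩ := hF₂ _ hy 1 one_pos
  have hsub : ∀ w, i (y + w) - i y = i w := fun w => by simp
  have hVmem : ∀ w, interpNorm i μ (i w) ≤ min 1 (min (rV / 2) (r₁ / 2)) → i (y + w) ∈ V := by
    intro w hw
    refine hopen _ (apply_mem_interpSpace hμ.2 _) ?_
    rw [hsub]
    have : min 1 (min (rV / 2) (r₁ / 2)) ≤ rV / 2 := (min_le_right _ _).trans (min_le_left _ _)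
    linarith
  refine ⟨min 1 (min (rV / 2) (r₁ / 2)), ⟨by positivity, min_le_left _ _⟩, |L|, abs_nonneg _, C,
    hC, m, b, ρ, hbρ, hVmem, fun w₁ w₂ hw₁ hw₂ => ?_⟩
  have hr : min 1 (min (rV / 2) (r₁ / 2)) < r₁ :=
    ((min_le_right _ _).trans (min_le_right _ _)).trans_lt (by linarith)
  have h1 : min 1 (min (rV / 2) (r₁ / 2)) ≤ 1 := min_le_left _ _
  have hV₁ := hVmem w₁ hw₁
  have hV₂ := hVmem w₂ hw₂
  have hd : i (y + w₁) - i (y + w₂) = i (w₁ - w₂) := by rw [← map_sub]; congr 1; abel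
  have hLip : ∀ x₁ ∈ V, ∀ x₂ ∈ V, interpNorm i μ (x₁ - i y) < r₁ → interpNorm i μ (x₂ - i y) < r₁ →
      ‖A x₁ - A x₂‖ ≤ |L| * interpNorm i μ (x₁ - x₂) ∧
      ‖F₁ x₁ - F₁ x₂‖ ≤ |L| * interpNorm i μ (x₁ - x₂) := fun x₁ h₁ x₂ h₂ h₁' h₂' => by
    have h3 := mul_le_mul_of_nonneg_right (le_abs_self L)
      (interpNorm_nonneg (i := i) (θ := μ) (x₁ - x₂))
    exact ⟨(hL _ h₁ _ h₂ h₁' h₂').1.trans h3, (hL _ h₁ _ h₂ h₁' h₂').2.trans h3⟩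
  have hA := hLip _ hV₁ _ hV₂ (by rw [hsub]; linarith) (by rw [hsub]; linarith)
  have hA' := hLip _ hV₁ _ hy (by rw [hsub]; linarith) (by rw [sub_self, interpNorm_zero]; exact hr₁)
  rw [hd] at hA
  rw [hsub] at hA'
  have hF := hF₂ _ ⟨hV₁, apply_mem_interpSpace hβ.2 _⟩ _ ⟨hV₂, apply_mem_interpSpace hβ.2 _⟩
    (by rw [hsub]; linarith) (by rw [hsub]; linarith)
  rw [hd] at hF
  -- The operator difference is arranged so that `w₁ - w₂` meets `A(y + w₁) - A(y)`, which is small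
  -- in operator norm near `y`.
  have hdec : remainder i A F₁ F₂ y w₁ - remainder i A F₁ F₂ y w₂ =
      (F₁ (i (y + w₁)) - F₁ (i (y + w₂))) + (F₂ (i (y + w₁)) - F₂ (i (y + w₂))) -
      (A (i (y + w₁)) - A (i y)) (w₁ - w₂) -
      (A (i (y + w₁)) - A (i (y + w₂))) (y + w₂) := by
    simp only [remainder, sub_apply, map_add, map_sub]
    abel
  rw [hdec]
  have e1 : ‖(A (i (y + w₁)) - A (i y)) (w₁ - w₂)‖ ≤ |L| * interpNorm i μ (i w₁) * ‖w₁ - w₂‖ :=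
    (ContinuousLinearMap.le_opNorm _ _).trans (mul_le_mul_of_nonneg_right hA'.1 (norm_nonneg _))
  have e2 : ‖(A (i (y + w₁)) - A (i (y + w₂))) (y + w₂)‖ ≤
      |L| * interpNorm i μ (i (w₁ - w₂)) * (‖y‖ + ‖w₂‖) :=
    (ContinuousLinearMap.le_opNorm _ _).trans (mul_le_mul hA.1 (norm_add_le _ _) (norm_nonneg _)
      (mul_nonneg (abs_nonneg _) (interpNorm_nonneg _)))
  refine (norm_sub_le _ _).trans ((add_le_add_left (norm_sub_le _ _) _).trans
    ((add_le_add_left (add_le_add_left (norm_add_le _ _) _) _).trans ?_))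
  linarith [hA.2]

/-- Smallness of the Lipschitz constant of the remainder, with the (possibly critical) time weight
of `𝔼_{1,μ}`. -/
theorem exists_remainder_lipschitz (hμ : μ ∈ Ioo (0 : ℝ) 1) (hV : IsOpenInInterp i μ V)
    (hH1 : HypH1 i μ V A F₁) (hH2 : HypH2 i μ V F₂ β) (hy : i y ∈ V) :
    ∃ K > (0 : ℝ), ∃ r₀ ∈ Ioc (0 : ℝ) 1, (∀ w, interpNorm i μ (i w) ≤ r₀ → i (y + w) ∈ V) ∧
      ∀ t a r D D₁ : ℝ, 0 < t → t ≤ a → a ≤ 1 → r ≤ r₀ → D₁ ≤ D → ∀ w₁ w₂,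
        interpNorm i μ (i w₁) ≤ r → interpNorm i μ (i w₂) ≤ r →
        t ^ (1 - μ) * ‖w₁‖ ≤ a → t ^ (1 - μ) * ‖w₂‖ ≤ a →
        interpNorm i μ (i (w₁ - w₂)) ≤ D → t ^ (1 - μ) * ‖w₁ - w₂‖ ≤ D₁ →
        t ^ (1 - μ) * ‖remainder i A F₁ F₂ y w₁ - remainder i A F₁ F₂ y w₂‖ ≤
          K * (r * D₁ + a ^ (1 - β) * D) := by
  obtain ⟨r₀, hr₀, L, hL, C, hC, m, b, ρ, hbρ, hVmem, hsub⟩ :=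
    exists_remainder_sub_le hμ hV hH1 hH2 hy
  have hβ := hH2.1
  set c := interpNorm i β (i y) with hc
  have hc0 : 0 ≤ c := interpNorm_nonneg _
  have hS0 : 0 ≤ ∑ j, (1 + (c + 1) ^ ρ j + (c + 1) ^ ρ j) :=
    Finset.sum_nonneg fun j _ => by positivity
  refine ⟨L * (2 + ‖y‖) + C * ∑ j, (1 + (c + 1) ^ ρ j + (c + 1) ^ ρ j) + 1 + L, by positivity, r₀,
    hr₀, hVmem, ?_⟩
  intro t a r D D₁ ht hta ha hr hD w₁ w₂ h₁ h₂ h₁' h₂' hd hd'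
  have ha0 : 0 < a := ht.trans_le hta
  have ht1 : t ≤ 1 := hta.trans ha
  have hw0 : 0 < t ^ (1 - μ) := Real.rpow_pos_of_pos ht _
  have hD₁0 : 0 ≤ D₁ := le_trans (by positivity) hd'
  have hD0 : 0 ≤ D := hD₁0.trans hD
  have hr0 : 0 ≤ r := (interpNorm_nonneg _).trans h₁
  have haβ : 0 < a ^ (1 - β) := Real.rpow_pos_of_pos ha0 _
  have hta' : t ^ (1 - μ) ≤ a ^ (1 - β) :=
    (Real.rpow_le_rpow ht.le hta (by linarith [hμ.2])).trans
      (Real.rpow_le_rpow_of_exponent_ge ha0 ha (by linarith [hβ.1]))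
  have haa : a ≤ a ^ (1 - β) := by
    simpa using Real.rpow_le_rpow_of_exponent_ge ha0 ha (by linarith [hβ.1, hμ.1] : 1 - β ≤ 1)
  have hnorm : ∀ (w : E₁) (P : ℝ), t ^ (1 - μ) * ‖w‖ ≤ P → ‖w‖ ≤ t ^ (μ - 1) * P := by
    intro w P h
    have h3 : t ^ (μ - 1) * t ^ (1 - μ) = 1 := by rw [← Real.rpow_add ht]; simp
    calc ‖w‖ = t ^ (μ - 1) * (t ^ (1 - μ) * ‖w‖) := by rw [← mul_assoc, h3, one_mul]
      _ ≤ _ := mul_le_mul_of_nonneg_left h (by positivity)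
  have hat1 : 1 ≤ a / t := (one_le_div ht).2 hta
  have hbeta : ∀ w, interpNorm i μ (i w) ≤ r → t ^ (1 - μ) * ‖w‖ ≤ a →
      interpNorm i β (i (y + w)) ≤ (c + 1) * (a / t) ^ (β - μ) := by
    intro w hw hw'
    have h3 : interpNorm i β (i w) ≤ (a / t) ^ (β - μ) := by
      -- Interpolating at the scale `t / a` rather than `t` retains a positive power of the small
      -- number `a`.
      refine interpNorm_apply_le_of_le hμ.1.le hβ.1.le hβ.2 (a := t / a) (by positivity)
        (hw.trans (hr.trans hr₀.2)) (hnorm w a hw') (le_of_eq ?_) ?_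
      · rw [mul_one, ← inv_div, Real.inv_rpow (by positivity), ← Real.rpow_neg (by positivity)]
        congr 1; ring
      · have e1 : (t / a) ^ (1 - β) * (t ^ (μ - 1) * a) = a ^ β * t ^ (-(β - μ)) := by
          rw [Real.div_rpow ht.le ha0.le, div_eq_mul_inv, ← Real.rpow_neg ha0.le]
          have e2 : a ^ (-(1 - β)) * a = a ^ β := by
            rw [← Real.rpow_add_one ha0.ne']; congr 1; ring
          have e3 : t ^ (1 - β) * t ^ (μ - 1) = t ^ (-(β - μ)) := by
            rw [← Real.rpow_add ht]; congr 1; ring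
          rw [← e2, ← e3]; ring
        rw [e1, Real.div_rpow ha0.le ht.le, div_eq_mul_inv, ← Real.rpow_neg ht.le]
        exact mul_le_mul_of_nonneg_right
          (Real.rpow_le_rpow_of_exponent_ge ha0 ha (by linarith [hμ.1])) (by positivity)
    have h4 : (1 : ℝ) ≤ (a / t) ^ (β - μ) := Real.one_le_rpow hat1 (by linarith [hβ.1])
    have h5 := interpNorm_add_le (hμ.1.le.trans hβ.1.le) (apply_mem_interpSpace (i := i) hβ.2 y)
      (apply_mem_interpSpace (i := i) hβ.2 w)
    rw [← map_add] at h5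
    have h6 : c ≤ c * (a / t) ^ (β - μ) := le_mul_of_one_le_right hc0 h4
    linarith
  have hterm : ∀ j, t ^ (1 - μ) * ((1 + interpNorm i β (i (y + w₁)) ^ ρ j +
      interpNorm i β (i (y + w₂)) ^ ρ j) * interpNorm i (b j) (i (w₁ - w₂))) ≤
      (1 + (c + 1) ^ ρ j + (c + 1) ^ ρ j) * (a ^ (1 - β) * D) := by
    intro j
    obtain ⟨hb, hρ, hcrit⟩ := hbρ j
    have hb1 : b j < 1 := hb.2.trans_lt hβ.2
    have hcrit' : ρ j * (β - μ) + (b j - μ) ≤ 1 - μ := by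
      rwa [div_le_one (by linarith [hμ.2])] at hcrit
    have hq1 : 1 ≤ (a / t) ^ (ρ j * (β - μ)) :=
      Real.one_le_rpow hat1 (mul_nonneg hρ (by linarith [hβ.1]))
    have hpow : ∀ w, interpNorm i μ (i w) ≤ r → t ^ (1 - μ) * ‖w‖ ≤ a →
        interpNorm i β (i (y + w)) ^ ρ j ≤ (c + 1) ^ ρ j * (a / t) ^ (ρ j * (β - μ)) := by
      intro w hw hw'
      refine (Real.rpow_le_rpow (interpNorm_nonneg _) (hbeta w hw hw') hρ).trans (le_of_eq ?_)
      rw [Real.mul_rpow (by positivity) (by positivity), ← Real.rpow_mul (by positivity),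
        mul_comm (β - μ)]
    have hbd : interpNorm i (b j) (i (w₁ - w₂)) ≤ t ^ (μ - b j) * D := by
      refine interpNorm_apply_le_of_le hμ.1.le hb.1 hb1 ht hd (hnorm _ _ (hd'.trans hD)) le_rfl
        (le_of_eq ?_)
      rw [← mul_assoc, ← Real.rpow_add ht]; ring_nf
    have hsum : 1 + interpNorm i β (i (y + w₁)) ^ ρ j + interpNorm i β (i (y + w₂)) ^ ρ j ≤
        (1 + (c + 1) ^ ρ j + (c + 1) ^ ρ j) * (a / t) ^ (ρ j * (β - μ)) := by
      have := hpow w₁ h₁ h₁'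
      have := hpow w₂ h₂ h₂'
      linarith
    -- The exponent `1 - b j - ρ j * (β - μ)` of `t` is nonnegative by (H2) and zero in the critical
    -- case, where no power of `t` is gained. Bounding `t` by `a` leaves `a ^ (1 - b j)`, so the
    -- smallness comes from the weighted bound `a` on `w₁` and `w₂`.
    have hexp : t ^ (1 - μ) * (a / t) ^ (ρ j * (β - μ)) * t ^ (μ - b j) ≤ a ^ (1 - β) := by
      have e1 : t ^ (1 - μ) * (a / t) ^ (ρ j * (β - μ)) * t ^ (μ - b j) =
          t ^ (1 - b j - ρ j * (β - μ)) * a ^ (ρ j * (β - μ)) := by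
        have e2 : t ^ (1 - b j - ρ j * (β - μ)) =
            t ^ (1 - μ) * t ^ (μ - b j) * t ^ (-(ρ j * (β - μ))) := by
          rw [← Real.rpow_add ht, ← Real.rpow_add ht]; congr 1; ring
        rw [e2, Real.div_rpow ha0.le ht.le, div_eq_mul_inv, ← Real.rpow_neg ht.le]
        ring
      rw [e1]
      calc _ ≤ a ^ (1 - b j - ρ j * (β - μ)) * a ^ (ρ j * (β - μ)) :=
            mul_le_mul_of_nonneg_right (Real.rpow_le_rpow ht.le hta (by linarith)) (by positivity)
        _ = a ^ (1 - b j) := by rw [← Real.rpow_add ha0]; congr 1; ring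
        _ ≤ _ := Real.rpow_le_rpow_of_exponent_ge ha0 ha (by linarith [hb.2])
    calc _ ≤ t ^ (1 - μ) * (((1 + (c + 1) ^ ρ j + (c + 1) ^ ρ j) * (a / t) ^ (ρ j * (β - μ))) *
          (t ^ (μ - b j) * D)) := by
          refine mul_le_mul_of_nonneg_left (mul_le_mul hsum hbd (interpNorm_nonneg _) ?_) hw0.le
          positivity
      _ = (1 + (c + 1) ^ ρ j + (c + 1) ^ ρ j) *
          (t ^ (1 - μ) * (a / t) ^ (ρ j * (β - μ)) * t ^ (μ - b j) * D) := by ring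
      _ ≤ _ := mul_le_mul_of_nonneg_left (mul_le_mul_of_nonneg_right hexp hD0) (by positivity)
  have hsumle := Finset.sum_le_sum fun j (_ : j ∈ Finset.univ) => hterm j
  rw [← Finset.mul_sum, ← Finset.sum_mul] at hsumle
  have hN := mul_le_mul_of_nonneg_left (hsub w₁ w₂ (h₁.trans hr) (h₂.trans hr)) hw0.le
  refine hN.trans ?_
  have p1 : t ^ (1 - μ) * (1 + ‖y‖ + ‖w₂‖) ≤ (2 + ‖y‖) * a ^ (1 - β) := by
    have := mul_le_mul_of_nonneg_right hta' (norm_nonneg y)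
    linarith
  have p2 : L * interpNorm i μ (i (w₁ - w₂)) * (t ^ (1 - μ) * (1 + ‖y‖ + ‖w₂‖)) ≤
      L * D * ((2 + ‖y‖) * a ^ (1 - β)) := by
    have := interpNorm_nonneg (i := i) (θ := μ) (i (w₁ - w₂))
    gcongr
  have p3 : L * interpNorm i μ (i w₁) * (t ^ (1 - μ) * ‖w₁ - w₂‖) ≤ L * r * D₁ := by
    have := interpNorm_nonneg (i := i) (θ := μ) (i w₁)
    gcongr
  have p4 := mul_le_mul_of_nonneg_left hsumle hC.le
  have q1 : 0 ≤ (L * (2 + ‖y‖) + C * ∑ j, (1 + (c + 1) ^ ρ j + (c + 1) ^ ρ j) + 1) * (r * D₁) := by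
    positivity
  have q2 : 0 ≤ (1 + L) * (a ^ (1 - β) * D) := by positivity
  linarith

/-- In the spaces `E_ν` with `ν ≥ β` the remainder is subcritical. -/
theorem exists_remainder_bound (hμ : μ ∈ Ioo (0 : ℝ) 1) (hV : IsOpenInInterp i μ V)
    (hH1 : HypH1 i μ V A F₁) (hH2 : HypH2 i μ V F₂ β) (hy : IsEquilibrium i V A F₁ F₂ y)
    {ν : ℝ} (hν : ν ∈ Ico β 1) :
    ∃ K > (0 : ℝ), ∃ r₀ ∈ Ioc (0 : ℝ) 1, ∀ t r R : ℝ, 0 < t → r ≤ r₀ → R ≤ 1 → ∀ w,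
      interpNorm i μ (i w) ≤ r → interpNorm i ν (i w) ≤ R → t ^ (1 - ν) * ‖w‖ ≤ R →
      t ^ (1 - ν) * ‖remainder i A F₁ F₂ y w‖ ≤ K * ((r + t ^ (1 - ν)) * R) := by
  obtain ⟨r₀, hr₀, L, hL, C, hC, m, b, ρ, hbρ, hVmem, hsub⟩ :=
    exists_remainder_sub_le hμ hV hH1 hH2 hy.1
  have hβ := hH2.1
  set c := interpNorm i β (i y) with hc
  have hc0 : 0 ≤ c := interpNorm_nonneg _
  set e := max 1 ‖i‖ with he
  have he1 : 1 ≤ e := le_max_left _ _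
  have hS0 : 0 ≤ ∑ j, (1 + (c + e) ^ ρ j + (c + e) ^ ρ j) :=
    Finset.sum_nonneg fun j _ => by positivity
  refine ⟨L * e * (1 + ‖y‖) + L + C * ((∑ j, (1 + (c + e) ^ ρ j + (c + e) ^ ρ j)) * e) + 1,
    by positivity, r₀, hr₀, ?_⟩
  intro t r R ht hr hR w h₁ h₂ h₃
  have hw0 : 0 < t ^ (1 - ν) := Real.rpow_pos_of_pos ht _
  have hR0 : 0 ≤ R := (interpNorm_nonneg _).trans h₂
  have hr0 : 0 ≤ r := (interpNorm_nonneg _).trans h₁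
  -- Since `β ≤ ν`, every interpolation norm in the remainder estimate is dominated by the
  -- `E_ν`-norm. No singularity in time arises, and the factor `t ^ (1 - ν)` is gained in full.
  have hemb : ∀ θ ∈ Icc μ ν, interpNorm i θ (i w) ≤ e * R := fun θ hθ =>
    (interpNorm_le_interpNorm (hμ.1.le.trans hθ.1) hθ.2 (apply_mem_interpSpace hν.2 w)).trans
      (mul_le_mul_of_nonneg_left h₂ (by positivity))
  have hmain := hsub w 0 (h₁.trans hr) (by simpa [interpNorm_zero] using hr₀.1.le)
  rw [hy.remainder_zero, sub_zero, sub_zero, add_zero, norm_zero, add_zero] at hmain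
  have hβw : interpNorm i β (i (y + w)) ≤ c + e := by
    have h5 := interpNorm_add_le (hμ.1.le.trans hβ.1.le) (apply_mem_interpSpace (i := i) hβ.2 y)
      (apply_mem_interpSpace (i := i) hβ.2 w)
    rw [← map_add] at h5
    have h6 := hemb β ⟨hβ.1.le, hν.1⟩
    have h7 : e * R ≤ e := mul_le_of_le_one_right (by positivity) hR
    linarith
  have hterm : ∀ j, (1 + interpNorm i β (i (y + w)) ^ ρ j + c ^ ρ j) *
      interpNorm i (b j) (i w) ≤ (1 + (c + e) ^ ρ j + (c + e) ^ ρ j) * (e * R) := by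
    intro j
    obtain ⟨hb, hρ, -⟩ := hbρ j
    have h4 := hemb (b j) ⟨hb.1, hb.2.trans hν.1⟩
    have h5 := Real.rpow_le_rpow (interpNorm_nonneg _) hβw hρ
    have h6 := Real.rpow_le_rpow hc0 (by linarith : c ≤ c + e) hρ
    exact mul_le_mul (by linarith) h4 (interpNorm_nonneg _) (by positivity)
  have hsumle := Finset.sum_le_sum fun j (_ : j ∈ Finset.univ) => hterm j
  rw [← Finset.sum_mul] at hsumle
  have hμw := hemb μ ⟨le_rfl, hβ.1.le.trans hν.1⟩
  have p1 : L * interpNorm i μ (i w) * (1 + ‖y‖) ≤ L * (e * R) * (1 + ‖y‖) := by gcongr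
  have p2 : L * interpNorm i μ (i w) * (t ^ (1 - ν) * ‖w‖) ≤ L * r * R := by
    have := interpNorm_nonneg (i := i) (θ := μ) (i w)
    gcongr
  have p3 := mul_le_mul_of_nonneg_left (mul_le_mul_of_nonneg_left hsumle hC.le) hw0.le
  have p4 := mul_le_mul_of_nonneg_left p1 hw0.le
  have p5 := mul_le_mul_of_nonneg_left hmain hw0.le
  have q1 : 0 ≤ (L * e * (1 + ‖y‖) + C * ((∑ j, (1 + (c + e) ^ ρ j + (c + e) ^ ρ j)) * e) + 1) *
    (r * R) := by positivity
  have q2 : 0 ≤ (L + 1) * (t ^ (1 - ν) * R) := by positivity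
  linarith

end QuasiPar

/-! ### A continuity argument in time, and the local nonlinear theory -/

namespace QuasiPar

section Bootstrap

/-- At the infimum of the times where `r < c t`, continuity from the left gives `c ≤ r`, the step
improves this to a strict inequality, and continuity then excludes such times nearby. Small times
are a separate hypothesis because `c` need not extend continuously to `0`. -/
theorem le_of_bootstrap {c : ℝ → ℝ} {τ r : ℝ} (hc : ContinuousOn c (Ioc 0 τ))
    (h0 : ∀ᶠ t in 𝓝[>] (0 : ℝ), c t ≤ r)
    (hstep : ∀ t ∈ Ioc 0 τ, (∀ s ∈ Ioc 0 t, c s ≤ r) → c t < r) : ∀ t ∈ Ioc 0 τ, c t ≤ r := by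
  by_contra! hcon
  obtain ⟨t₁, ht₁, hct₁⟩ := hcon
  set S := {t | t ∈ Ioc 0 τ ∧ r < c t} with hS
  have hSne : S.Nonempty := ⟨t₁, ht₁, hct₁⟩
  have hSbdd : BddBelow S := ⟨0, fun t ht => ht.1.1.le⟩
  obtain ⟨δ, hδ, hδ'⟩ := mem_nhdsGT_iff_exists_Ioo_subset.1 h0
  have hpos : 0 < sInf S := lt_of_lt_of_le hδ <| le_csInf hSne fun t ht => by
    by_contra! hlt
    exact (hδ' ⟨ht.1.1, hlt⟩).not_gt ht.2
  have hmem : sInf S ∈ Ioc 0 τ := ⟨hpos, (csInf_le hSbdd ⟨ht₁, hct₁⟩).trans ht₁.2⟩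
  have hlow : ∀ s ∈ Ioo 0 (sInf S), c s ≤ r := fun s hs => by
    by_contra! hlt
    exact (csInf_le hSbdd ⟨⟨hs.1, hs.2.le.trans hmem.2⟩, hlt⟩).not_gt hs.2
  have hle : c (sInf S) ≤ r := by
    by_contra! hlt
    have h1 : ∀ᶠ s in 𝓝[<] (sInf S), r < c s :=
      ((hc _ hmem).eventually_const_lt hlt).filter_mono <| by
        refine le_inf (inf_le_left) (le_principal_iff.2 ?_)
        filter_upwards [Ioo_mem_nhdsLT hpos] with s hs using ⟨hs.1, hs.2.le.trans hmem.2⟩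
    obtain ⟨s, hs, hs'⟩ := (h1.and (Ioo_mem_nhdsLT hpos)).exists
    exact (hlow s hs').not_gt hs
  have hlt := hstep _ hmem fun s hs => hs.2.lt_or_eq.elim (fun h => hlow s ⟨hs.1, h⟩)
    fun h => h ▸ hle
  obtain ⟨u, hu, hu'⟩ := mem_nhdsWithin.1 ((hc _ hmem).eventually_lt_const hlt)
  obtain ⟨d, hd, hdu⟩ := Metric.isOpen_iff.1 hu _ hu'.1
  obtain ⟨t, ht, htd⟩ := exists_lt_of_csInf_lt hSne (lt_add_of_pos_right (sInf S) hd)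
  refine (hu'.2 ⟨hdu ?_, ht.1⟩ : c t < r).not_gt ht.2
  rw [Metric.mem_ball, Real.dist_eq, abs_of_nonneg (sub_nonneg.2 (csInf_le hSbdd ht))]
  linarith

theorem norm_rpow_smul {E : Type*} [NormedAddCommGroup E] [NormedSpace ℝ E] {t : ℝ} (ht : 0 < t)
    (a : ℝ) (e : E) : ‖t ^ a • e‖ = t ^ a * ‖e‖ := by
  rw [norm_smul, Real.norm_of_nonneg (Real.rpow_nonneg ht.le _)]

end Bootstrap

variable {E₀ E₁ : Type*} [NormedAddCommGroup E₀] [NormedSpace ℝ E₀]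
  [NormedAddCommGroup E₁] [NormedSpace ℝ E₁]
  {i B : E₁ →L[ℝ] E₀} {μ ν T C ε R : ℝ} {N : E₁ → E₀} {x : E₀}

theorem continuous_interpNorm_apply (hμ : μ ∈ Ioo (0 : ℝ) 1) :
    Continuous fun w : E₁ => interpNorm i μ (i w) := by
  refine (LipschitzWith.of_le_add_mul ⟨max 1 ‖i‖, by positivity⟩ fun w w' => ?_).continuous
  have h1 := interpNorm_add_le hμ.1.le (apply_mem_interpSpace (i := i) hμ.2 w')
    (apply_mem_interpSpace (i := i) hμ.2 (w - w'))
  rw [← map_add, add_sub_cancel] at h1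
  have h2 := interpNorm_apply_le (i := i) hμ (w - w')
  rw [dist_eq_norm]
  exact h1.trans (add_le_add_right h2 _)

/-! ### Local theory for `w' + B w = N(w)` -/

/-- The weighted estimate for the linear problem in the space `E_ν`, on all `[0, τ]`, `τ ≤ ε`. -/
def LinearEstimate (i : E₁ →L[ℝ] E₀) (μ : ℝ) (B : E₁ →L[ℝ] E₀) (ν C ε : ℝ) : Prop :=
  ∀ τ ∈ Ioc 0 ε, ∀ x ∈ interpSpace i ν, ∀ g v, IsMild i μ τ B x g v → ∀ G,
    (∀ s ∈ Ioc 0 τ, s ^ (1 - ν) * ‖g s‖ ≤ G) → ∀ t ∈ Ioc 0 τ,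
    t ^ (1 - ν) * ‖v t‖ ≤ C * (interpNorm i ν x + G) ∧
    interpNorm i ν (i (v t)) ≤ C * (interpNorm i ν x + G)

/-- `N` is a contraction, with constant `1 / (4 C)`, near `0` in the weighted spaces. -/
structure IsSmallRemainder (i : E₁ →L[ℝ] E₀) (μ C ε : ℝ) (N : E₁ → E₀) : Prop where
  zero : N 0 = 0
  lipschitz : ∀ t ∈ Ioc 0 ε, ∀ D, ∀ w₁ w₂,
    interpNorm i μ (i w₁) ≤ ε → interpNorm i μ (i w₂) ≤ ε →
    t ^ (1 - μ) * ‖w₁‖ ≤ ε → t ^ (1 - μ) * ‖w₂‖ ≤ ε →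
    interpNorm i μ (i (w₁ - w₂)) ≤ D → t ^ (1 - μ) * ‖w₁ - w₂‖ ≤ D →
    t ^ (1 - μ) * ‖N w₁ - N w₂‖ ≤ D / (4 * C)
  vanishing : ∀ w : ℝ → E₁, (∀ t ∈ Ioc 0 ε, interpNorm i μ (i (w t)) ≤ ε) →
    Tendsto (fun t : ℝ => t ^ (1 - μ) * ‖w t‖) (𝓝[>] 0) (𝓝 0) →
    Tendsto (fun t : ℝ => t ^ (1 - μ) * ‖N (w t)‖) (𝓝[>] 0) (𝓝 0)

namespace IsSmallRemainder

theorem norm_le (hN : IsSmallRemainder i μ C ε N) {t D : ℝ} (ht : t ∈ Ioc 0 ε) (hD : D ≤ ε) {w : E₁}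
    (h₁ : interpNorm i μ (i w) ≤ D) (h₂ : t ^ (1 - μ) * ‖w‖ ≤ D) :
    t ^ (1 - μ) * ‖N w‖ ≤ D / (4 * C) := by
  have hε : 0 ≤ ε := ht.1.le.trans ht.2
  simpa [hN.zero] using hN.lipschitz t ht D w 0 (h₁.trans hD) (by simpa [interpNorm_zero] using hε)
    (h₂.trans hD) (by simpa using hε) (by simpa using h₁) (by simpa using h₂)

theorem isBC_comp (hμ : μ ∈ Ioo (0 : ℝ) 1) (hN : IsSmallRemainder i μ C ε N) {w : ℝ → E₁}
    (hw : IsBC μ ε w) (h₁ : ∀ t ∈ Ioc 0 ε, interpNorm i μ (i (w t)) ≤ ε)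
    (h₂ : ∀ t ∈ Ioc 0 ε, t ^ (1 - μ) * ‖w t‖ ≤ ε) : IsBC μ ε (fun t => N (w t)) := by
  refine ⟨fun t₀ ht₀ => ?_, ⟨ε / (4 * C), fun t ht => ?_⟩, ?_⟩
  -- Near `t₀` the Lipschitz estimate is applied with the weight frozen at `t₀ / 2`. The bounds on
  -- `w` persist because the weight is increasing, and `M` majorizes both the embedding constant and
  -- the frozen weight.
  · have hp : 0 < t₀ / 2 := half_pos ht₀.1
    have hq : 0 < (t₀ / 2) ^ (1 - μ) := Real.rpow_pos_of_pos hp _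
    set M := max 1 ‖i‖ + (t₀ / 2) ^ (1 - μ) with hM
    have hM' : max 1 ‖i‖ ≤ M := by rw [hM]; linarith
    have hM'' : (t₀ / 2) ^ (1 - μ) ≤ M := by rw [hM]; linarith [le_max_left 1 ‖i‖]
    have hlow : ∀ s ∈ Ioc 0 ε, t₀ / 2 ≤ s → (t₀ / 2) ^ (1 - μ) * ‖w s‖ ≤ ε := fun s hs hs' =>
      (mul_le_mul_of_nonneg_right (Real.rpow_le_rpow hp.le hs' (by linarith [hμ.2]))
        (norm_nonneg _)).trans (h₂ s hs)
    rw [ContinuousWithinAt, tendsto_iff_norm_sub_tendsto_zero]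
    have hlim : Tendsto (fun s => ((t₀ / 2) ^ (1 - μ))⁻¹ * (M * ‖w s - w t₀‖ / (4 * C)))
        (𝓝[Ioc 0 ε] t₀) (𝓝 0) := by
      have := tendsto_iff_norm_sub_tendsto_zero.1 (hw.continuousOn t₀ ht₀)
      simpa using ((this.const_mul M).div_const (4 * C)).const_mul ((t₀ / 2) ^ (1 - μ))⁻¹
    refine tendsto_of_tendsto_of_tendsto_of_le_of_le' tendsto_const_nhds hlim
      (.of_forall fun _ => norm_nonneg _) ?_
    filter_upwards [self_mem_nhdsWithin, mem_nhdsWithin_of_mem_nhds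
      (Ioi_mem_nhds (half_lt_self ht₀.1))] with s hs hs'
    have h := hN.lipschitz (t₀ / 2) ⟨hp, (half_le_self ht₀.1.le).trans ht₀.2⟩ (M * ‖w s - w t₀‖)
      (w s) (w t₀) (h₁ s hs) (h₁ t₀ ht₀) (hlow s hs (le_of_lt hs'))
      (hlow t₀ ht₀ (half_le_self ht₀.1.le))
      ((interpNorm_apply_le hμ _).trans (mul_le_mul_of_nonneg_right hM' (norm_nonneg _)))
      (mul_le_mul_of_nonneg_right hM'' (norm_nonneg _))
    rwa [le_inv_mul_iff₀ hq]
  · rw [norm_rpow_smul ht.1]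
    exact hN.norm_le ht le_rfl (h₁ t ht) (h₂ t ht)
  · refine (hN.vanishing w h₁ (hw.vanishing.congr' ?_)).congr' ?_
    · filter_upwards [self_mem_nhdsWithin] with t ht using norm_rpow_smul ht _ _
    · filter_upwards [self_mem_nhdsWithin] with t ht using (norm_rpow_smul ht _ _).symm

/-- A priori bound for every solution starting near `0` in `E_μ`. -/
theorem a_priori (hμ : μ ∈ Ioo (0 : ℝ) 1) (hC : 0 < C) (hN : IsSmallRemainder i μ C ε N)
    (hlin : LinearEstimate i μ B μ C ε) {τ : ℝ} (hτ : τ ∈ Ioc 0 ε) (hx : x ∈ interpSpace i μ)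
    {w : ℝ → E₁} (hw : IsMild i μ τ B x (fun t => N (w t)) w) {r : ℝ} (hr : r ∈ Ioc 0 ε)
    (hxr : 4 * C * interpNorm i μ x ≤ r) :
    ∀ t ∈ Ioc 0 τ, t ^ (1 - μ) * ‖w t‖ ≤ r ∧ interpNorm i μ (i (w t)) ≤ r := by
  have key : ∀ t ∈ Ioc 0 τ, (∀ s ∈ Ioc 0 t, s ^ (1 - μ) * ‖N (w s)‖ ≤ r / (4 * C)) →
      max (t ^ (1 - μ) * ‖w t‖) (interpNorm i μ (i (w t))) < r := by
    intro t ht hG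
    have h1 := hlin t ⟨ht.1, ht.2.trans hτ.2⟩ x hx _ _ (hw.mono ht.2) _ hG t ⟨ht.1, le_rfl⟩
    have h2 : C * (interpNorm i μ x + r / (4 * C)) < r := by
      have h3 : C * (r / (4 * C)) = r / 4 := by field_simp
      rw [mul_add, h3]
      linarith [hr.1]
    exact max_lt (h1.1.trans_lt h2) (h1.2.trans_lt h2)
  have hcont : ContinuousOn (fun t => max (t ^ (1 - μ) * ‖w t‖) (interpNorm i μ (i (w t))))
      (Ioc 0 τ) := by
    refine ContinuousOn.sup (ContinuousOn.mul (fun t ht => (Real.continuousAt_rpow_const t _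
      (Or.inl ht.1.ne')).continuousWithinAt) hw.bc.continuousOn.norm) ?_
    exact (continuous_interpNorm_apply hμ).comp_continuousOn hw.bc.continuousOn
  -- The `E_μ`-norm of `w t` need not tend to `0`, so small times are handled through the weighted
  -- right-hand side, which does vanish at `0`, and the linear estimate.
  have h0 : ∀ᶠ t in 𝓝[>] (0 : ℝ),
      max (t ^ (1 - μ) * ‖w t‖) (interpNorm i μ (i (w t))) ≤ r := by
    have h1 := hw.bc_rhs.vanishing.eventually_le_const (show 0 < r / (4 * C) by
      have := hr.1; positivity)
    obtain ⟨δ, hδ, hδ'⟩ := mem_nhdsGT_iff_exists_Ioo_subset.1 h1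
    filter_upwards [Ioo_mem_nhdsGT hδ, Ioc_mem_nhdsGT hτ.1] with t ht ht'
    refine (key t ht' fun s hs => ?_).le
    have h2 : ‖s ^ (1 - μ) • N (w s)‖ ≤ r / (4 * C) := hδ' ⟨hs.1, hs.2.trans_lt ht.2⟩
    rwa [norm_smul, Real.norm_of_nonneg (Real.rpow_nonneg hs.1.le _)] at h2
  have := le_of_bootstrap hcont h0 fun t ht h => key t ht fun s hs =>
    hN.norm_le ⟨hs.1, hs.2.trans (ht.2.trans hτ.2)⟩ hr.2 ((le_max_right _ _).trans (h s hs))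
      ((le_max_left _ _).trans (h s hs))
  exact fun t ht => max_le_iff.1 (this t ht)

/-- Both solutions obey the a priori bound, so their difference is at most `2 ε` in both norms. Each
pass through the Lipschitz and linear estimates divides this bound by `4`. -/
theorem eqOn (hμ : μ ∈ Ioo (0 : ℝ) 1) (hC : 0 < C) (hN : IsSmallRemainder i μ C ε N)
    (hlin : LinearEstimate i μ B μ C ε) {τ : ℝ} (hτ : τ ∈ Ioc 0 ε) (hx : x ∈ interpSpace i μ)
    (hxε : 4 * C * interpNorm i μ x ≤ ε) {w₁ w₂ : ℝ → E₁}
    (hw₁ : IsMild i μ τ B x (fun t => N (w₁ t)) w₁)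
    (hw₂ : IsMild i μ τ B x (fun t => N (w₂ t)) w₂) : EqOn w₁ w₂ (Ioc 0 τ) := by
  have hε : ε ∈ Ioc 0 ε := ⟨hτ.1.trans_le hτ.2, le_rfl⟩
  have b₁ := hN.a_priori hμ hC hlin hτ hx hw₁ hε hxε
  have b₂ := hN.a_priori hμ hC hlin hτ hx hw₂ hε hxε
  have hd := hw₁.sub hμ hτ.1 hw₂
  rw [sub_self] at hd
  have h0 : (0 : E₀) ∈ interpSpace i μ := by simpa using apply_mem_interpSpace (i := i) hμ.2 0
  have hdecay : ∀ n : ℕ, ∀ t ∈ Ioc 0 τ, t ^ (1 - μ) * ‖w₁ t - w₂ t‖ ≤ 2 * ε * (1 / 4) ^ n ∧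
      interpNorm i μ (i (w₁ t - w₂ t)) ≤ 2 * ε * (1 / 4) ^ n := by
    intro n
    induction n with
    | zero =>
      intro t ht
      have h1 := mul_le_mul_of_nonneg_left (norm_sub_le (w₁ t) (w₂ t))
        (Real.rpow_nonneg ht.1.le (1 - μ))
      have h2 := interpNorm_add_le hμ.1.le (apply_mem_interpSpace (i := i) hμ.2 (w₁ t))
        (neg_mem_interpSpace (apply_mem_interpSpace (i := i) hμ.2 (w₂ t)))
      rw [interpNorm_neg, ← sub_eq_add_neg, ← map_sub] at h2
      have := b₁ t ht
      have := b₂ t ht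
      constructor <;> linarith
    | succ n ih =>
      intro t ht
      have h1 := hlin τ hτ 0 h0 _ _ hd (2 * ε * (1 / 4) ^ n / (4 * C)) (fun s hs =>
        hN.lipschitz s ⟨hs.1, hs.2.trans hτ.2⟩ _ _ _ (b₁ s hs).2 (b₂ s hs).2 (b₁ s hs).1
          (b₂ s hs).1 (ih s hs).2 (ih s hs).1) t ht
      have h2 : C * (interpNorm i μ (0 : E₀) + 2 * ε * (1 / 4) ^ n / (4 * C)) =
          2 * ε * (1 / 4) ^ (n + 1) := by
        rw [interpNorm_zero, zero_add, pow_succ]; field_simp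
      rwa [h2] at h1
  intro t ht
  have hlim : Tendsto (fun n : ℕ => 2 * ε * (1 / 4 : ℝ) ^ n) atTop (𝓝 0) := by
    simpa using (tendsto_pow_atTop_nhds_zero_of_lt_one (by norm_num : (0 : ℝ) ≤ 1 / 4)
      (by norm_num)).const_mul (2 * ε)
  have h1 : t ^ (1 - μ) * ‖w₁ t - w₂ t‖ ≤ 0 := ge_of_tendsto' hlim fun n => (hdecay n t ht).1
  have h2 : ‖w₁ t - w₂ t‖ ≤ 0 := nonpos_of_mul_nonpos_right h1 (Real.rpow_pos_of_pos ht.1 _)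
  exact sub_eq_zero.1 (norm_le_zero_iff.1 h2)

variable [CompleteSpace E₀]

/-- Existence on `[0, ε]` by the contraction principle, with a bound in `E_ν`. -/
theorem exists_solution (hμ : μ ∈ Ioo (0 : ℝ) 1) (hC : 0 < C) (hε : 0 < ε)
    (hN : IsSmallRemainder i μ C ε N) (hlin : LinearEstimate i μ B μ C ε)
    (hex : ∀ x ∈ interpSpace i μ, ∀ g, IsBC μ ε g → ∃ v, IsMild i μ ε B x g v)
    (hlinν : LinearEstimate i μ B ν C ε)
    (hNν : ∀ t ∈ Ioc 0 ε, ∀ D ≤ ε, ∀ w, interpNorm i μ (i w) ≤ ε → t ^ (1 - μ) * ‖w‖ ≤ ε →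
      interpNorm i ν (i w) ≤ D → t ^ (1 - ν) * ‖w‖ ≤ D → t ^ (1 - ν) * ‖N w‖ ≤ D / (4 * C))
    (hx : x ∈ interpSpace i μ) (hxε : 4 * C * interpNorm i μ x ≤ ε)
    (hxν : x ∈ interpSpace i ν) (hR : R ∈ Ioc 0 ε) (hxR : 4 * C * interpNorm i ν x ≤ R) :
    ∃ w, IsMild i μ ε B x (fun t => N (w t)) w ∧ ∀ t ∈ Ioc 0 ε, interpNorm i ν (i (w t)) ≤ R := by
  -- The contraction acts on weighted right-hand sides rather than on solutions, so the sup norm of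
  -- `C([0, ε], E₀)` provides completeness. The `E_ν`-constraint is closed under uniform convergence
  -- and only has to be preserved; contraction is needed in the weight `μ` alone.
  let S : Set C(Icc (0 : ℝ) ε, E₀) := {γ | γ ⟨0, le_rfl, hε.le⟩ = 0 ∧ ‖γ‖ ≤ ε / (4 * C) ∧
    ∀ t ∈ Ioc 0 ε, t ^ (1 - ν) * ‖unweight μ hε.le γ t‖ ≤ R / (4 * C)}
  have hScl : IsClosed S := by
    have heq : {γ : C(Icc (0 : ℝ) ε, E₀) | ∀ t ∈ Ioc 0 ε,
        t ^ (1 - ν) * ‖unweight μ hε.le γ t‖ ≤ R / (4 * C)} = ⋂ t, ⋂ (_ : t ∈ Ioc 0 ε),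
        {γ | t ^ (1 - ν) * ‖unweight μ hε.le γ t‖ ≤ R / (4 * C)} := by
      ext; simp only [mem_iInter]; rfl
    have hcl : IsClosed {γ : C(Icc (0 : ℝ) ε, E₀) | ∀ t ∈ Ioc 0 ε,
        t ^ (1 - ν) * ‖unweight μ hε.le γ t‖ ≤ R / (4 * C)} := by
      rw [heq]
      refine isClosed_iInter fun t => isClosed_iInter fun _ => isClosed_le ?_ continuous_const
      exact continuous_const.mul (((continuous_eval_const _).const_smul _).norm)
    exact (isClosed_eq (continuous_eval_const _) continuous_const).inter
      ((isClosed_le continuous_norm continuous_const).inter hcl)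
  have hCS : CompleteSpace S := hScl.completeSpace_coe
  have hzero : (0 : C(Icc (0 : ℝ) ε, E₀)) ∈ S := by
    have := hR.1
    refine ⟨rfl, by rw [norm_zero]; positivity, fun t ht => ?_⟩
    simp only [unweight, ContinuousMap.zero_apply, smul_zero, norm_zero, mul_zero]
    positivity
  have hne : Nonempty S := ⟨⟨0, hzero⟩⟩
  have hhalf : ∀ a P, 4 * C * a ≤ P → 0 < P → C * (a + P / (4 * C)) ≤ P := fun a P h hP => by
    have h3 : C * (P / (4 * C)) = P / 4 := by field_simp
    rw [mul_add, h3]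
    linarith
  have hstep : ∀ γ : S, ∃ γ' : S, ∃ w, IsMild i μ ε B x (unweight μ hε.le γ.1) w ∧
      (∀ t ∈ Ioc 0 ε, t ^ (1 - μ) * ‖w t‖ ≤ ε ∧ interpNorm i μ (i (w t)) ≤ ε) ∧
      (∀ t ∈ Ioc 0 ε, interpNorm i ν (i (w t)) ≤ R) ∧
      (∀ t, γ'.1 t = (t : ℝ) ^ (1 - μ) • N (w t)) ∧
      EqOn (unweight μ hε.le γ'.1) (fun t => N (w t)) (Ioc 0 ε) := by
    rintro ⟨γ, hγ0, hγε, hγR⟩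
    obtain ⟨w, hw⟩ := hex x hx _ (isBC_unweight hμ.2 hε hγ0)
    have hεε : ε ∈ Ioc 0 ε := ⟨hε, le_rfl⟩
    have bμ : ∀ t ∈ Ioc 0 ε, t ^ (1 - μ) * ‖w t‖ ≤ ε ∧ interpNorm i μ (i (w t)) ≤ ε := by
      intro t ht
      have h1 := hlin ε hεε x hx _ _ hw _
        (fun s hs => (norm_unweight_le hε γ hs.1).trans hγε) t ht
      have h2 := hhalf _ _ hxε hε
      exact ⟨h1.1.trans h2, h1.2.trans h2⟩
    have bν : ∀ t ∈ Ioc 0 ε, t ^ (1 - ν) * ‖w t‖ ≤ R ∧ interpNorm i ν (i (w t)) ≤ R := by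
      intro t ht
      have h1 := hlinν ε hεε x hxν _ _ hw _ hγR t ht
      have h2 := hhalf _ _ hxR hR.1
      exact ⟨h1.1.trans h2, h1.2.trans h2⟩
    obtain ⟨γ', hγ'0, hγ', hγ'eq⟩ := (hN.isBC_comp hμ hw.bc (fun t ht => (bμ t ht).2)
      fun t ht => (bμ t ht).1).exists_unweight hμ.2 hε
    refine ⟨⟨γ', hγ'0, ?_, fun t ht => ?_⟩, w, hw, bμ, fun t ht => (bν t ht).2, hγ', hγ'eq⟩
    · refine (ContinuousMap.norm_le _ (by positivity)).2 fun ⟨t, ht⟩ => ?_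
      rcases ht.1.eq_or_lt with rfl | ht0
      · rw [hγ'0, norm_zero]; positivity
      · rw [hγ', norm_smul, Real.norm_of_nonneg (Real.rpow_nonneg ht.1 _)]
        have ht' : t ∈ Ioc 0 ε := ⟨ht0, ht.2⟩
        exact hN.norm_le ht' le_rfl (bμ t ht').2 (bμ t ht').1
    · rw [hγ'eq ht]
      exact hNν t ht R hR.2 _ (bμ t ht).2 (bμ t ht).1 (bν t ht).2 (bν t ht).1
  choose Ψ w hw hbμ hbν hval hΨ using hstep
  have hcontr : ContractingWith (1 / 4) Ψ := by
    refine ⟨by rw [← NNReal.coe_lt_coe]; norm_num, LipschitzWith.of_dist_le_mul fun γ₁ γ₂ => ?_⟩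
    rw [Subtype.dist_eq, Subtype.dist_eq, dist_eq_norm, dist_eq_norm]
    have h0 : (0 : E₀) ∈ interpSpace i μ := by simpa using apply_mem_interpSpace (i := i) hμ.2 0
    have hd := (hw γ₁).sub hμ hε (hw γ₂)
    rw [sub_self] at hd
    have hest := hlin ε ⟨hε, le_rfl⟩ 0 h0 _ _ hd ‖γ₁.1 - γ₂.1‖ fun s hs => by
      have := norm_unweight_le (μ := μ) hε (γ₁.1 - γ₂.1) hs.1
      simpa only [unweight, ContinuousMap.sub_apply, smul_sub] using this
    rw [interpNorm_zero, zero_add] at hest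
    refine (ContinuousMap.norm_le _ (by positivity)).2 fun ⟨t, ht⟩ => ?_
    rw [ContinuousMap.sub_apply, hval, hval, ← smul_sub, norm_smul,
      Real.norm_of_nonneg (Real.rpow_nonneg ht.1 _)]
    rcases ht.1.eq_or_lt with rfl | ht0
    · simp only [Real.zero_rpow (by linarith [hμ.2] : (1 - μ) ≠ 0), zero_mul]
      positivity
    · have ht' : t ∈ Ioc 0 ε := ⟨ht0, ht.2⟩
      refine (hN.lipschitz t ht' _ _ _ (hbμ γ₁ t ht').2 (hbμ γ₂ t ht').2 (hbμ γ₁ t ht').1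
        (hbμ γ₂ t ht').1 (hest t ht').2 (hest t ht').1).trans (le_of_eq ?_)
      have : ((1 / 4 : NNReal) : ℝ) = 1 / 4 := by norm_num
      rw [this]
      field_simp
  have hfix := hcontr.fixedPoint_isFixedPt
  set γ := hcontr.fixedPoint
  refine ⟨w γ, (hw γ).congr hε (fun t ht => ?_) fun _ _ => rfl, hbν γ⟩
  have := hΨ γ ht
  rw [hfix] at this
  exact this.symm

end IsSmallRemainder

end QuasiPar

namespace QuasiPar
variable {E₀ E₁ : Type*} [NormedAddCommGroup E₀] [NormedSpace ℝ E₀]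
  [NormedAddCommGroup E₁] [NormedSpace ℝ E₁]
  {i : E₁ →L[ℝ] E₀} {μ β T : ℝ} {V : Set E₀} {A : E₀ → E₁ →L[ℝ] E₀} {F₁ F₂ : E₀ → E₀} {y : E₁}

/-! ### Solutions of the quasilinear problem -/

section Solutions

variable [CompleteSpace E₀] {x : E₀} {u : ℝ → E₀}

/-- The term `A(y) w` is added on both sides, so `y` need not be an equilibrium. The choice `y = 0`
serves for restricting, shifting and gluing solutions, the equilibrium for estimates. -/
theorem IsSolution.exists_isMild (hμ : μ ∈ Ioo (0 : ℝ) 1) (hT : 0 < T) (y : E₁)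
    (h : IsSolution i μ V A F₁ F₂ T x u) :
    u 0 = x ∧ (∀ t ∈ Icc 0 T, u t ∈ V) ∧ ∃ w : ℝ → E₁, (∀ t ∈ Ioc 0 T, u t = i (y + w t)) ∧
      IsMild i μ T (A (i y)) (x - i y) (fun t => remainder i A F₁ F₂ y (w t)) w := by
  obtain ⟨v, u', hu, hx, hV, he⟩ := h
  refine ⟨hx, hV, fun t => v t - y, fun t ht => by rw [add_sub_cancel, hu.lift t ht], ?_⟩
  have hm := (hu.isMild (B := A (i y)) hμ hT).sub hμ hT (IsMild.const hμ.2 hT y)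
  rw [hx] at hm
  refine hm.congr hT (fun t ht => ?_) fun _ _ => rfl
  have h1 := he t ht
  rw [← hu.lift t ht] at h1
  simp only [remainder, add_sub_cancel, map_sub (A (i y)), ← h1]
  abel

theorem IsMild.isSolution (hμ : μ ∈ Ioo (0 : ℝ) 1) (hT : 0 < T) {w : ℝ → E₁}
    (h : IsMild i μ T (A (i y)) (x - i y) (fun t => remainder i A F₁ F₂ y (w t)) w)
    (hu0 : u 0 = x) (hu : ∀ t ∈ Ioc 0 T, u t = i (y + w t)) (hV : ∀ t ∈ Icc 0 T, u t ∈ V) :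
    IsSolution i μ V A F₁ F₂ T x u := by
  have hm := (IsMild.const (i := i) (B := A (i y)) hμ.2 hT y).add hμ hT h
  rw [add_sub_cancel] at hm
  refine ⟨_, _, hm.isMaxRegFun hμ hT hu0 hu, hu0, hV, fun t ht => ?_⟩
  rw [hu t ht]
  simp only [remainder, map_add (A (i y))]
  abel

theorem IsSolution.mono (hμ : μ ∈ Ioo (0 : ℝ) 1) (h : IsSolution i μ V A F₁ F₂ T x u) {T' : ℝ}
    (hT' : 0 < T') (hTT : T' ≤ T) : IsSolution i μ V A F₁ F₂ T' x u := by
  obtain ⟨hx, hV, w, hw, hm⟩ := h.exists_isMild hμ (hT'.trans_le hTT) 0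
  exact (hm.mono hTT).isSolution hμ hT' hx (fun t ht => hw t ⟨ht.1, ht.2.trans hTT⟩)
    fun t ht => hV t ⟨ht.1, ht.2.trans hTT⟩

theorem IsSolution.shift (hμ : μ ∈ Ioo (0 : ℝ) 1) (h : IsSolution i μ V A F₁ F₂ T x u) {a : ℝ}
    (ha : 0 < a) (haT : a < T) :
    IsSolution i μ V A F₁ F₂ (T - a) (u a) (fun s => u (a + s)) := by
  obtain ⟨hx, hV, w, hw, hm⟩ := h.exists_isMild hμ (ha.trans haT) 0
  have hs := hm.shift hμ ha haT
  have hwa := hw a ⟨ha, haT.le⟩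
  refine IsMild.isSolution (y := 0) (w := fun s => w (a + s)) hμ (sub_pos.2 haT) ?_
    (by rw [add_zero]) (fun t ht => hw (a + t) ⟨by linarith [ht.1], by linarith [ht.2]⟩)
    fun t ht => hV (a + t) ⟨by linarith [ht.1], by linarith [ht.2]⟩
  rw [hwa, zero_add, map_zero, sub_zero]
  simpa using hs

/-- Two solutions can be concatenated at time `a` if they agree shortly after `a`. -/
theorem IsSolution.glue (hi : Function.Injective i) (hμ : μ ∈ Ioo (0 : ℝ) 1) {a b : ℝ} (ha : 0 < a)
    (hab : a < b) (haT : a < T) (h : IsSolution i μ V A F₁ F₂ b x u) {u' : ℝ → E₀}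
    (h' : IsSolution i μ V A F₁ F₂ (T - a) (u a) u')
    (heq : ∀ᶠ s in 𝓝[>] (0 : ℝ), u' s = u (a + s)) :
    IsSolution i μ V A F₁ F₂ T x (fun t => if t ≤ a then u t else u' (t - a)) := by
  have hT : 0 < T := ha.trans haT
  have hTa : 0 < T - a := sub_pos.2 haT
  obtain ⟨hx, hV, w, hw, hm⟩ := h.exists_isMild hμ (ha.trans hab) 0
  obtain ⟨hx', hV', w', hw', hm'⟩ := h'.exists_isMild hμ hTa 0
  have hww : ∀ᶠ s in 𝓝[>] (0 : ℝ), w' s = w (a + s) := by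
    filter_upwards [heq, Ioc_mem_nhdsGT hTa, Ioc_mem_nhdsGT (sub_pos.2 hab)] with s hs hs1 hs2
    have := hw (a + s) ⟨by linarith [hs1.1], by linarith [hs2.2]⟩
    rw [← hs, hw' s hs1] at this
    simpa using hi this
  have hshift : Tendsto (fun s => a + s) (𝓝[>] 0) (𝓝 a) := by
    have : Tendsto (fun s : ℝ => a + s) (𝓝 0) (𝓝 (a + 0)) := tendsto_id.const_add a
    rw [add_zero] at this
    exact this.mono_left nhdsWithin_le_nhds
  have hnhds : Ioc 0 b ∈ 𝓝 a := Ioc_mem_nhds ha hab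
  -- Agreement to the right of `a` transfers the interior continuity of `w` and of its remainder at
  -- `a` to the second solution, as `IsMild.glue` requires.
  have hwt : Tendsto w' (𝓝[>] 0) (𝓝 (w a)) :=
    (((hm.bc.continuousOn.continuousAt hnhds).tendsto).comp hshift).congr'
      (hww.mono fun s hs => hs.symm)
  have hgt : Tendsto (fun s => remainder i A F₁ F₂ 0 (w' s)) (𝓝[>] 0)
      (𝓝 (remainder i A F₁ F₂ 0 (w a))) :=
    (((hm.bc_rhs.continuousOn.continuousAt hnhds).tendsto).comp hshift).congr'
      (hww.mono fun s hs => by simp only [Function.comp_apply, hs])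
  have hua : u a - i 0 = i (w a) := by rw [hw a ⟨ha, hab.le⟩]; simp
  rw [hua] at hm'
  have hg := (hm.mono hab.le).glue hμ ha haT hm' hwt hgt
  refine IsMild.isSolution (y := 0) hμ hT (hg.congr hT (fun t _ => ?_) fun _ _ => rfl)
    (by simp [ha.le, hx]) (fun t ht => ?_) fun t ht => ?_
  · split_ifs <;> rfl
  · rcases le_or_gt t a with hta | hta
    · simp only [if_pos hta]; exact hw t ⟨ht.1, hta.trans hab.le⟩
    · simp only [if_neg hta.not_ge]; exact hw' _ ⟨by linarith, by linarith [ht.2]⟩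
  · rcases le_or_gt t a with hta | hta
    · simp only [if_pos hta]; exact hV t ⟨ht.1, hta.trans hab.le⟩
    · simp only [if_neg hta.not_ge]; exact hV' _ ⟨by linarith, by linarith [ht.2]⟩

end Solutions

/-! ### Uniform local constants at an equilibrium -/

/-- The weighted function is frozen at its value at `τ`. Solvability on `[0, T]` thereby passes to
shorter intervals. -/
theorem IsBC.exists_extend {E : Type*} [NormedAddCommGroup E] [NormedSpace ℝ E] (hμ : μ < 1) {τ : ℝ}
    (hτ : 0 < τ) (hτT : τ ≤ T) {g : ℝ → E} (hg : IsBC μ τ g) :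
    ∃ g', IsBC μ T g' ∧ EqOn g' g (Ioc 0 τ) := by
  refine ⟨fun t => t ^ (μ - 1) • (min t τ) ^ (1 - μ) • g (min t τ), ?_, fun t ht => ?_⟩
  · rw [isBC_iff hμ (hτ.trans_le hτT)]
    have h := ((isBC_iff hμ hτ).1 hg).comp (f := fun t => min t τ) (s := Icc 0 T) (by fun_prop)
      fun t ht => ⟨le_min ht.1 hτ.le, min_le_right _ _⟩
    refine h.congr fun t ht => ?_
    rcases ht.1.eq_or_lt with rfl | ht0
    · simp [hτ.le, Real.zero_rpow (by linarith : (1 - μ) ≠ 0)]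
    · exact rpow_smul_rpow_smul ht0 μ _
  · simp only [min_eq_left ht.2]
    exact rpow_smul_rpow_smul' ht.1 μ _

theorem MildSolvable.exists_sol_of_le {B : E₁ →L[ℝ] E₀} (hμ : μ < 1) (h : MildSolvable i μ T B)
    {τ : ℝ} (hτ : 0 < τ) (hτT : τ ≤ T) : ∀ x ∈ interpSpace i μ, ∀ g, IsBC μ τ g →
      ∃ v, IsMild i μ τ B x g v := by
  intro x hx g hg
  obtain ⟨g', hg', heq⟩ := hg.exists_extend hμ hτ hτT
  obtain ⟨v, hv⟩ := h.exists_sol x hx g' hg'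
  exact ⟨v, (hv.mono hτT).congr hτ heq.symm fun _ _ => rfl⟩

theorem tendsto_add_rpow {θ : ℝ} (hθ : θ < 1) (K : ℝ) :
    Tendsto (fun a : ℝ => K * (a + a ^ (1 - θ))) (𝓝[>] 0) (𝓝 0) := by
  have h1 : Tendsto (fun a : ℝ => K * (a + a ^ (1 - θ))) (𝓝 0) (𝓝 (K * (0 + 0 ^ (1 - θ)))) :=
    (tendsto_id.add (Real.continuousAt_rpow_const 0 (1 - θ)
      (Or.inr (by linarith))).tendsto).const_mul K
  rw [Real.zero_rpow (by linarith), add_zero, mul_zero] at h1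
  exact h1.mono_left nhdsWithin_le_nhds

/-- A single `ε` bounds the time, the `E_μ`-radius and the weighted `E₁`-norm, since the resulting
Lipschitz constant `K (ε + ε ^ (1 - β))` tends to `0`. -/
theorem exists_isSmallRemainder (hμ : μ ∈ Ioo (0 : ℝ) 1) (hV : IsOpenInInterp i μ V)
    (hH1 : HypH1 i μ V A F₁) (hH2 : HypH2 i μ V F₂ β) (hy : IsEquilibrium i V A F₁ F₂ y)
    {C : ℝ} (hC : 0 < C) :
    ∀ᶠ ε in 𝓝[>] (0 : ℝ), IsSmallRemainder i μ C ε (remainder i A F₁ F₂ y) ∧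
      ∀ w, interpNorm i μ (i w) ≤ ε → i (y + w) ∈ V := by
  obtain ⟨K, hK, r₀, hr₀, hVmem, hlip⟩ := exists_remainder_lipschitz hμ hV hH1 hH2 hy.1
  have hsmall := (tendsto_add_rpow hH2.1.2 K).eventually_le_const
    (show 0 < 1 / (4 * C) by positivity)
  filter_upwards [hsmall, Ioc_mem_nhdsGT hr₀.1] with ε hε hε'
  have hε1 : ε ≤ 1 := hε'.2.trans hr₀.2
  refine ⟨⟨hy.remainder_zero, fun t ht D w₁ w₂ a₁ a₂ b₁ b₂ c₁ c₂ => ?_, fun w hw hlim => ?_⟩,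
    fun w hw => hVmem w (hw.trans hε'.2)⟩
  · have hD : 0 ≤ D := (interpNorm_nonneg _).trans c₁
    have h := hlip t ε ε D D ht.1 ht.2 hε1 hε'.2 le_rfl w₁ w₂ a₁ a₂ b₁ b₂ c₁ c₂
    calc _ ≤ K * (ε + ε ^ (1 - β)) * D := by linarith
      _ ≤ 1 / (4 * C) * D := mul_le_mul_of_nonneg_right hε hD
      _ = _ := by ring
  · rw [Metric.tendsto_nhds]
    intro κ hκ
    obtain ⟨a, ha, haε⟩ := (((tendsto_add_rpow hH2.1.2 K).eventually_lt_const hκ).and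
      (Ioc_mem_nhdsGT hε'.1)).exists
    filter_upwards [hlim.eventually_le_const haε.1, Ioc_mem_nhdsGT haε.1] with t ht hta
    have hz : interpNorm i μ (i (0 : E₁)) ≤ ε := by simpa [interpNorm_zero] using hε'.1.le
    have hwt := hw t ⟨hta.1, hta.2.trans haε.2⟩
    -- The comparison with `0` has `D = ε` and `D₁ = a`: in `E_μ` the function is merely bounded,
    -- while its weighted `E₁`-norm is eventually below the arbitrarily small `a`.
    have h := hlip t a ε ε a hta.1 hta.2 (haε.2.trans hε1) hε'.2 haε.2 (w t) 0 hwt hz ht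
      (by simpa using haε.1.le) (by simpa using hwt) (by simpa using ht)
    rw [hy.remainder_zero, sub_zero] at h
    have h0 : 0 ≤ t ^ (1 - μ) * ‖remainder i A F₁ F₂ y (w t)‖ :=
      mul_nonneg (Real.rpow_nonneg hta.1.le _) (norm_nonneg _)
    rw [dist_zero_right, Real.norm_of_nonneg h0]
    refine (h.trans ?_).trans_lt ha
    have h1 : 0 ≤ a ^ (1 - β) := Real.rpow_nonneg haε.1.le _
    have h2 : ε * a ≤ a := mul_le_of_le_one_left haε.1.le hε1
    have h3 : a ^ (1 - β) * ε ≤ a ^ (1 - β) := mul_le_of_le_one_right h1 hε1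
    exact mul_le_mul_of_nonneg_left (add_le_add h2 h3) hK.le

variable [CompleteSpace E₀] [CompleteSpace E₁]

theorem MildSolvable.exists_linearEstimate {B : E₁ →L[ℝ] E₀} (hi : Function.Injective i)
    (hμ : μ ∈ Ioo (0 : ℝ) 1) (hT : 0 < T) (h : MildSolvable i μ T B) {ν : ℝ}
    (hν : ν ∈ Ioo (0 : ℝ) 1) : ∃ C > 0, ∀ C' ≥ C, ∀ ε ≤ T, LinearEstimate i μ B ν C' ε := by
  obtain ⟨C, hC, hest⟩ := h.exists_estimate hi hμ hT hν
  refine ⟨C, hC, fun C' hC' ε hε τ hτ x hx g v hv G hG t ht => ?_⟩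
  have h1 := hest τ ⟨hτ.1, hτ.2.trans hε⟩ x hx g v hv G hG t ht
  have hG0 : 0 ≤ G := (mul_nonneg (Real.rpow_nonneg ht.1.le _) (norm_nonneg _)).trans (hG t ht)
  have h2 := mul_le_mul_of_nonneg_right hC' (add_nonneg (interpNorm_nonneg (i := i) (θ := ν) x) hG0)
  exact ⟨h1.1.trans h2, h1.2.trans h2⟩

/-- Everything needed on a short time interval, with uniform constants: estimates in `E_μ` and in
`E_ν`, solvability of the linear problem, and smallness of the remainder. -/
theorem exists_local_constants (hi : Function.Injective i) (hμ : μ ∈ Ioo (0 : ℝ) 1)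
    (hV : IsOpenInInterp i μ V) (hH1 : HypH1 i μ V A F₁) (hH2 : HypH2 i μ V F₂ β)
    (hy : IsEquilibrium i V A F₁ F₂ y) {ν : ℝ} (hν : ν ∈ Ico β 1) :
    ∃ C > 0, ∃ ε > 0, IsSmallRemainder i μ C ε (remainder i A F₁ F₂ y) ∧
      (∀ w, interpNorm i μ (i w) ≤ ε → i (y + w) ∈ V) ∧
      LinearEstimate i μ (A (i y)) μ C ε ∧ LinearEstimate i μ (A (i y)) ν C ε ∧
      (∀ x ∈ interpSpace i μ, ∀ g, IsBC μ ε g → ∃ v, IsMild i μ ε (A (i y)) x g v) ∧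
      ∀ t ∈ Ioc 0 ε, ∀ D ≤ ε, ∀ w, interpNorm i μ (i w) ≤ ε → t ^ (1 - μ) * ‖w‖ ≤ ε →
        interpNorm i ν (i w) ≤ D → t ^ (1 - ν) * ‖w‖ ≤ D →
        t ^ (1 - ν) * ‖remainder i A F₁ F₂ y w‖ ≤ D / (4 * C) := by
  have hν' : ν ∈ Ioo (0 : ℝ) 1 := ⟨hμ.1.trans (hH2.1.1.trans_le hν.1), hν.2⟩
  obtain ⟨T, hT, hms⟩ := exists_mildSolvable hi hμ (hH1.maxReg _ hy.1)
  obtain ⟨Cμ, hCμ, hlμ⟩ := hms.exists_linearEstimate hi hμ hT hμ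
  obtain ⟨Cν, hCν, hlν⟩ := hms.exists_linearEstimate hi hμ hT hν'
  set C := max Cμ Cν with hCdef
  have hC : 0 < C := lt_max_of_lt_left hCμ
  obtain ⟨K, hK, r₀, hr₀, hbd⟩ := exists_remainder_bound hμ hV hH1 hH2 hy hν
  obtain ⟨ε, ⟨⟨hsm, hVm⟩, hε₂⟩, hε₃, hε₄⟩ := (((exists_isSmallRemainder hμ hV hH1 hH2 hy hC).and
    ((tendsto_add_rpow hν.2 K).eventually_le_const (show 0 < 1 / (4 * C) by positivity))).and
    ((eventually_mem_set.2 (Ioc_mem_nhdsGT hT)).and (Ioc_mem_nhdsGT hr₀.1))).exists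
  refine ⟨C, hC, ε, hε₃.1, hsm, hVm, hlμ C (le_max_left _ _) ε hε₃.2,
    hlν C (le_max_right _ _) ε hε₃.2, hms.exists_sol_of_le hμ.2 hε₃.1 hε₃.2, ?_⟩
  intro t ht D hD w h₁ _ h₃ h₄
  have hD0 : 0 ≤ D := (interpNorm_nonneg _).trans h₃
  have h := hbd t ε D ht.1 hε₄.2 (hD.trans (hε₄.2.trans hr₀.2)) w h₁ h₃ h₄
  have h5 : t ^ (1 - ν) ≤ ε ^ (1 - ν) := Real.rpow_le_rpow ht.1.le ht.2 (by linarith [hν.2])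
  calc _ ≤ K * ((ε + t ^ (1 - ν)) * D) := h
    _ ≤ K * ((ε + ε ^ (1 - ν)) * D) := by gcongr
    _ = K * (ε + ε ^ (1 - ν)) * D := by ring
    _ ≤ 1 / (4 * C) * D := mul_le_mul_of_nonneg_right hε₂ hD0
    _ = _ := by ring

end QuasiPar

namespace QuasiPar
/-! ### Equivalence of the stability notions -/

theorem norm_le_of_rpow_mul_le {E : Type*} [NormedAddCommGroup E] {μ t P : ℝ} (ht : 0 < t) {w : E} (h : t ^ (1 - μ) * ‖w‖ ≤ P) :
    ‖w‖ ≤ t ^ (μ - 1) * P := by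
  have h3 : t ^ (μ - 1) * t ^ (1 - μ) = 1 := by rw [← Real.rpow_add ht]; simp
  calc ‖w‖ = t ^ (μ - 1) * (t ^ (1 - μ) * ‖w‖) := by rw [← mul_assoc, h3, one_mul]
    _ ≤ _ := mul_le_mul_of_nonneg_left h (by positivity)

/-- A positive number below finitely many positive thresholds, some of them scaled. -/
theorem exists_pos_forall_mul_lt {m : ℕ} (c d : Fin m → ℝ) (hd : ∀ j, 0 < d j) :
    ∃ δ > 0, ∀ j, c j * δ < d j := by
  have h : ∀ᶠ δ in 𝓝[>] (0 : ℝ), ∀ j, c j * δ < d j := by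
    refine eventually_all.2 fun j => ?_
    have h1 : Tendsto (fun δ : ℝ => c j * δ) (𝓝 0) (𝓝 (c j * 0)) := tendsto_id.const_mul (c j)
    rw [mul_zero] at h1
    exact (h1.mono_left nhdsWithin_le_nhds).eventually_lt_const (hd j)
  obtain ⟨δ, h1, h2⟩ := (h.and self_mem_nhdsWithin).exists
  exact ⟨δ, h2, h1⟩

variable {E₀ E₁ : Type*} [NormedAddCommGroup E₀] [NormedSpace ℝ E₀] [CompleteSpace E₀]
  [NormedAddCommGroup E₁] [NormedSpace ℝ E₁] [CompleteSpace E₁]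
  {i : E₁ →L[ℝ] E₀} {μ β ν : ℝ} {V : Set E₀} {A : E₀ → E₁ →L[ℝ] E₀} {F₁ F₂ : E₀ → E₀} {y : E₁}

/-- Global existence is inherited because `E_ν` embeds in `E_μ`. Times up to `ε` use the
`E_ν`-bounded solution and uniqueness, later times a restart and smoothing. -/
theorem IsStableIn.of_le (hi : Function.Injective i) (hμ : μ ∈ Ioo (0 : ℝ) 1)
    (hV : IsOpenInInterp i μ V) (hH1 : HypH1 i μ V A F₁) (hH2 : HypH2 i μ V F₂ β)
    (hν : ν ∈ Ico β 1) (hy : IsEquilibrium i V A F₁ F₂ y)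
    (h : IsStableIn i μ V A F₁ F₂ μ (i y)) : IsStableIn i μ V A F₁ F₂ ν (i y) := by
  have hμν : μ ≤ ν := hH2.1.1.le.trans hν.1
  have hν' : ν ∈ Ioo (0 : ℝ) 1 := ⟨hμ.1.trans_le hμν, hν.2⟩
  obtain ⟨C, hC, ε, hε, hN, -, hlin, hlinν, hex, hNν⟩ :=
    exists_local_constants hi hμ hV hH1 hH2 hy hν
  set e := max 1 ‖i‖ with he
  have he1 : 1 ≤ e := le_max_left _ _
  intro κ hκ
  -- The first condition admits `4 C ρ` as radius in the a priori bound; the second makes the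
  -- `E_ν`-norm after smoothing for time `ε` smaller than `κ`.
  obtain ⟨ρ, hρ, hρ'⟩ := exists_pos_forall_mul_lt ![4 * C, e * (ε ^ (μ - 1) * (4 * C))] ![ε, κ]
    (by simp [Fin.forall_fin_two, hε, hκ])
  simp only [Fin.forall_fin_two, Matrix.cons_val_zero, Matrix.cons_val_one] at hρ'
  obtain ⟨δμ, hδμ, hδ⟩ := h ρ hρ
  set R := min ε (κ / 2) with hRdef
  have hR : R ∈ Ioc 0 ε := ⟨lt_min hε (half_pos hκ), min_le_left _ _⟩
  have hRκ : R < κ := (min_le_right _ _).trans_lt (half_lt_self hκ)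
  -- The four conditions give, in order, `E_μ`-stability, the `E_ν`-radius `R` of the local
  -- solution, its `E_μ`-smallness, and the bound at `t = 0`.
  obtain ⟨δ, hδ0, hδ'⟩ := exists_pos_forall_mul_lt ![e, 4 * C, 4 * C * e, 1] ![δμ, R, ε, κ]
    (by simp [Fin.forall_fin_succ, hδμ, hR.1, hε, hκ])
  simp only [Fin.forall_fin_succ, Matrix.cons_val_zero, Matrix.cons_val_succ,
    IsEmpty.forall_iff, and_true, one_mul] at hδ'
  obtain ⟨hd1, hd2, hd3, hd4⟩ := hδ'
  refine ⟨δ, hδ0, fun x hx hxδ => ?_⟩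
  have hxμ : x ∈ interpSpace i μ := interpSpace_anti hμν hx
  have hzν : x - i y ∈ interpSpace i ν := sub_mem_interpSpace hx (apply_mem_interpSpace hν.2 y)
  have hzμ : x - i y ∈ interpSpace i μ := interpSpace_anti hμν hzν
  have hzle : interpNorm i μ (x - i y) ≤ e * interpNorm i ν (x - i y) :=
    interpNorm_le_interpNorm hμ.1.le hμν hzν
  have heδ : e * interpNorm i ν (x - i y) ≤ e * δ :=
    mul_le_mul_of_nonneg_left hxδ.le (by positivity)
  obtain ⟨hglob, hstab⟩ := hδ x hxμ (by linarith)
  refine ⟨hglob, fun T hT u hu t ht => ?_⟩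
  obtain ⟨hu0, -, w, huw, hw⟩ := hu.exists_isMild hμ hT y
  rcases ht.1.eq_or_lt with rfl | ht0
  · rw [hu0]; exact ⟨hx, by linarith⟩
  have hut := huw t ⟨ht0, ht.2⟩
  have hdiff : u t - i y = i (w t) := by rw [hut]; simp
  refine ⟨hut ▸ apply_mem_interpSpace hν.2 _, ?_⟩
  rcases le_or_gt t ε with htε | htε
  · have hx4 : 4 * C * interpNorm i μ (x - i y) ≤ ε :=
      (mul_le_mul_of_nonneg_left (hzle.trans heδ) (by positivity)).trans (by linarith)
    have hx4ν : 4 * C * interpNorm i ν (x - i y) ≤ R :=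
      (mul_le_mul_of_nonneg_left hxδ.le (by positivity)).trans hd2.le
    obtain ⟨w', hw', hbd⟩ := hN.exists_solution hμ hC hε hlin hex hlinν hNν hzμ hx4 hzν hR hx4ν
    have hτ : t ∈ Ioc 0 ε := ⟨ht0, htε⟩
    have heq := hN.eqOn hμ hC hlin hτ hzμ hx4 (hw.mono ht.2) (hw'.mono htε) ⟨ht0, le_rfl⟩
    rw [hdiff, heq]
    exact (hbd t hτ).trans_lt hRκ
  -- Restarting exactly `ε` before `t` makes the smoothing factor `ε ^ (μ - 1)` independent of `t`.
  · have ha : 0 < t - ε := sub_pos.2 htε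
    have haT : t - ε < T := by linarith [ht.2]
    obtain ⟨-, -, w', huw', hw'⟩ := (hu.shift hμ ha haT).exists_isMild hμ (sub_pos.2 haT) y
    have hεT : ε ≤ T - (t - ε) := by linarith [ht.2]
    have hsm := (hstab T hT u hu (t - ε) ⟨ha.le, haT.le⟩).2
    have hmem : u (t - ε) - i y ∈ interpSpace i μ :=
      sub_mem_interpSpace (hstab T hT u hu (t - ε) ⟨ha.le, haT.le⟩).1
        (apply_mem_interpSpace hμ.2 y)
    have hap := (hN.a_priori hμ hC hlin ⟨hε, le_rfl⟩ hmem (hw'.mono hεT) (r := 4 * C * ρ)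
      ⟨by positivity, hρ'.1.le⟩ (mul_le_mul_of_nonneg_left hsm.le (by positivity)) ε
      ⟨hε, le_rfl⟩).1
    have hut' := huw' ε ⟨hε, hεT⟩
    rw [sub_add_cancel] at hut'
    rw [hut', map_add, add_sub_cancel_left]
    calc _ ≤ e * ‖w' ε‖ := interpNorm_apply_le hν' _
      _ ≤ e * (ε ^ (μ - 1) * (4 * C * ρ)) :=
        mul_le_mul_of_nonneg_left (norm_le_of_rpow_mul_le hε hap) (by positivity)
      _ = e * (ε ^ (μ - 1) * (4 * C)) * ρ := by ring
      _ < κ := hρ'.2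

/-- Before time `ε / 2` local theory in `E_μ` suffices; at that time smoothing has put the solution
into the ball of `E_ν` where stability is known. -/
theorem IsStableIn.of_ge (hi : Function.Injective i) (hμ : μ ∈ Ioo (0 : ℝ) 1)
    (hV : IsOpenInInterp i μ V) (hH1 : HypH1 i μ V A F₁) (hH2 : HypH2 i μ V F₂ β)
    (hν : ν ∈ Ico β 1) (hy : IsEquilibrium i V A F₁ F₂ y)
    (h : IsStableIn i μ V A F₁ F₂ ν (i y)) : IsStableIn i μ V A F₁ F₂ μ (i y) := by
  have hμν : μ ≤ ν := hH2.1.1.le.trans hν.1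
  have hν' : ν ∈ Ioo (0 : ℝ) 1 := ⟨hμ.1.trans_le hμν, hν.2⟩
  obtain ⟨C, hC, ε, hε, hN, hVmem, hlin, -, hex, -⟩ :=
    exists_local_constants hi hμ hV hH1 hH2 hy hν
  obtain ⟨rV, hrV, hopen⟩ := hV.2 _ hy.1
  set e := max 1 ‖i‖ with he
  have he1 : 1 ≤ e := le_max_left _ _
  have he0 : 0 < e := by positivity
  intro κ hκ
  -- Division by `e` compensates the embedding constant from `E_ν` into `E_μ`.
  obtain ⟨δν, hδν, hδ⟩ := h (κ / e) (by positivity)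
  -- Stopping at half the local interval leaves the overlap `[ε / 2, ε]`, on which uniqueness
  -- identifies the local solution with the global one started at `ε / 2`.
  have ha : 0 < ε / 2 := half_pos hε
  have haε : ε / 2 < ε := half_lt_self hε
  -- The third condition places the solution at time `ε / 2` within `δν` in `E_ν`; the fourth
  -- permits uniqueness to be applied from that time on.
  obtain ⟨r, hr, hr'⟩ := exists_pos_forall_mul_lt ![1, 1, e * (ε / 2) ^ (μ - 1), 4 * C]
    ![ε, κ, δν, ε] (by simp [Fin.forall_fin_succ, hδν, hε, hκ])
  simp only [Fin.forall_fin_succ, Matrix.cons_val_zero, Matrix.cons_val_succ,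
    IsEmpty.forall_iff, and_true, one_mul] at hr'
  obtain ⟨hr1, hr2, hr3, hr4⟩ := hr'
  obtain ⟨δ, hδ0, hδ'⟩ := exists_pos_forall_mul_lt ![4 * C, 1, 1] ![r, κ, rV]
    (by simp [Fin.forall_fin_succ, hr, hκ, hrV])
  simp only [Fin.forall_fin_succ, Matrix.cons_val_zero, Matrix.cons_val_succ,
    IsEmpty.forall_iff, and_true, one_mul] at hδ'
  obtain ⟨hd1, hd2, hd3⟩ := hδ'
  refine ⟨δ, hδ0, fun x hx hxδ => ?_⟩
  have hz : x - i y ∈ interpSpace i μ := sub_mem_interpSpace hx (apply_mem_interpSpace hμ.2 y)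
  have hxr : 4 * C * interpNorm i μ (x - i y) ≤ r :=
    (mul_le_mul_of_nonneg_left hxδ.le (by positivity)).trans hd1.le
  have hxε : 4 * C * interpNorm i μ (x - i y) ≤ ε := hxr.trans hr1.le
  have hrε : r ∈ Ioc 0 ε := ⟨hr, hr1.le⟩
  have hsmall : ∀ w : E₁, (ε / 2) ^ (1 - μ) * ‖w‖ ≤ r → interpNorm i ν (i w) < δν := fun w hw =>
    calc _ ≤ e * ‖w‖ := interpNorm_apply_le hν' _
      _ ≤ e * ((ε / 2) ^ (μ - 1) * r) :=
        mul_le_mul_of_nonneg_left (norm_le_of_rpow_mul_le ha hw) he0.le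
      _ = e * (ε / 2) ^ (μ - 1) * r := by ring
      _ < δν := hr3
  constructor
  -- Here the auxiliary exponent is `μ` itself: an initial value in `E_μ` allows no bound in `E_ν`
  -- down to `t = 0`.
  · obtain ⟨w, hw, -⟩ := hN.exists_solution hμ hC hε hlin hex hlin
      (fun t ht D hD w _ _ h₁ h₂ => hN.norm_le ht hD h₁ h₂) hz hxε hz hrε hxr
    have hap := hN.a_priori hμ hC hlin ⟨hε, le_rfl⟩ hz hw hrε hxr
    let u : ℝ → E₀ := fun t => if t ≤ 0 then x else i (y + w t)
    have hu0 : u 0 = x := if_pos le_rfl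
    have hut : ∀ t ∈ Ioc 0 ε, u t = i (y + w t) := fun t ht => if_neg ht.1.not_ge
    have hsol : IsSolution i μ V A F₁ F₂ ε x u := by
      refine hw.isSolution hμ hε hu0 hut fun t ht => ?_
      rcases ht.1.eq_or_lt with rfl | ht0
      · rw [hu0]; exact hopen x hx (hxδ.trans hd3)
      · rw [hut t ⟨ht0, ht.2⟩]
        exact hVmem _ ((hap t ⟨ht0, ht.2⟩).2.trans hr1.le)
    have ham : ε / 2 ∈ Ioc 0 ε := ⟨ha, haε.le⟩
    have hua : u (ε / 2) - i y = i (w (ε / 2)) := by rw [hut _ ham]; simp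
    obtain ⟨⟨u', hu'⟩, -⟩ := hδ (u (ε / 2)) (hut _ ham ▸ apply_mem_interpSpace hν.2 _)
      (hua ▸ hsmall _ (hap _ ham).1)
    have hs0 : 0 < ε - ε / 2 := sub_pos.2 haε
    have hsε : ε - ε / 2 ∈ Ioc 0 ε := ⟨hs0, by linarith⟩
    obtain ⟨-, -, w₁, huw₁, hw₁⟩ := (hsol.shift hμ ha haε).exists_isMild hμ hs0 y
    obtain ⟨-, -, w₂, huw₂, hw₂⟩ := (hu' _ hs0).exists_isMild hμ hs0 y
    have heq : EqOn w₁ w₂ (Ioc 0 (ε - ε / 2)) :=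
      hN.eqOn hμ hC hlin hsε (hua ▸ apply_mem_interpSpace hμ.2 _)
        (hua ▸ (mul_le_mul_of_nonneg_left (hap _ ham).2 (by positivity)).trans hr4.le) hw₁ hw₂
    refine ⟨fun t => if t ≤ ε / 2 then u t else u' (t - ε / 2), fun T hT => ?_⟩
    -- Gluing needs a final time beyond `ε / 2`; shorter intervals are obtained by restriction.
    refine IsSolution.mono hμ (T := max T ε) ?_ hT (le_max_left _ _)
    have haT : ε / 2 < max T ε := haε.trans_le (le_max_right _ _)
    refine hsol.glue hi hμ ha haε haT (hu' _ (sub_pos.2 haT)) ?_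
    filter_upwards [Ioc_mem_nhdsGT hs0] with s hs
    rw [huw₂ s hs, huw₁ s hs, heq hs]
  · intro T hT u hu t ht
    obtain ⟨hu0, -, w, huw, hw⟩ := hu.exists_isMild hμ hT y
    rcases ht.1.eq_or_lt with rfl | ht0
    · rw [hu0]; exact ⟨hx, hxδ.trans hd2⟩
    have hut := huw t ⟨ht0, ht.2⟩
    refine ⟨hut ▸ apply_mem_interpSpace hμ.2 _, ?_⟩
    -- An arbitrary solution may live on less than `[0, ε]`, so the a priori bound is taken up to
    -- `min t ε`.
    have hτ : min t ε ∈ Ioc 0 ε := ⟨lt_min ht0 hε, min_le_right _ _⟩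
    have hap := hN.a_priori hμ hC hlin hτ hz (hw.mono ((min_le_left _ _).trans ht.2)) hrε hxr
    rcases le_or_gt t ε with htε | htε
    · have := (hap t ⟨ht0, le_min le_rfl htε⟩).2
      rw [hut, map_add, add_sub_cancel_left]
      linarith
    · have hat : ε / 2 < t := haε.trans htε
      have haT : ε / 2 < T := hat.trans_le ht.2
      have hwa := huw (ε / 2) ⟨ha, haT.le⟩
      have hua : u (ε / 2) - i y = i (w (ε / 2)) := by rw [hwa]; simp
      have hbd := (hδ (u (ε / 2)) (hwa ▸ apply_mem_interpSpace hν.2 _)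
        (hua ▸ hsmall _ (hap _ ⟨ha, le_min hat.le haε.le⟩).1)).2 _ (sub_pos.2 haT) _
        (hu.shift hμ ha haT) (t - ε / 2) ⟨by linarith, by linarith [ht.2]⟩
      simp only [add_sub_cancel] at hbd
      have h1 := interpNorm_le_interpNorm hμ.1.le hμν
        (sub_mem_interpSpace hbd.1 (apply_mem_interpSpace hν.2 y))
      have h2 := (lt_div_iff₀' he0).1 hbd.2
      exact h1.trans_lt h2

end QuasiPar

theorem proposition3p1 {E₀ E₁ : Type*}
    [NormedAddCommGroup E₀] [NormedSpace ℝ E₀] [CompleteSpace E₀]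
    [NormedAddCommGroup E₁] [NormedSpace ℝ E₁] [CompleteSpace E₁]
    (i : E₁ →L[ℝ] E₀) (hi : Function.Injective i) (hdense : DenseRange i)
    (μ : ℝ) (hμ : μ ∈ Set.Ioo (0 : ℝ) 1)
    (V : Set E₀) (hV : QuasiPar.IsOpenInInterp i μ V)
    (A : E₀ → E₁ →L[ℝ] E₀) (F₁ F₂ : E₀ → E₀)
    (hH1 : QuasiPar.HypH1 i μ V A F₁)
    (β : ℝ) (hH2 : QuasiPar.HypH2 i μ V F₂ β)
    (μbar : ℝ) (hμbar : μbar ∈ Set.Ico β 1)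
    (y : E₁) (hy : QuasiPar.IsEquilibrium i V A F₁ F₂ y) :
    QuasiPar.IsStableIn i μ V A F₁ F₂ μ (i y) ↔
      QuasiPar.IsStableIn i μ V A F₁ F₂ μbar (i y) :=
  ⟨.of_le hi hμ hV hH1 hH2 hμbar hy, .of_ge hi hμ hV hH1 hH2 hμbar hy⟩
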